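/- Let $\phi_j$, $j\ge 1$, be an orthonormal system in $\mathbb L_2(0,1)$. For $\varepsilon>0$ one observes $dY_\varepsilon(t)=S(t)\,dt+\varepsilon\,dw(t)$, $t\in[0,1]$, through its Fourier coefficients $y_{\varepsilon j}=\int_0^1\phi_j\,dY_\varepsilon=\theta_j+\varepsilon\xi_j$, where $\theta_j=\int_0^1 S\phi_j\,dt$ and the $\xi_j=\int_0^1\phi_j\,dw$ are independent standard Gaussian. Let $0<r<1/2$ and $0<2\omega<1-2r$, and put $s=\dfrac{r}{2-4r-2\omega}$. All relations $\asymp$ (two-sided bounds with positive constants) are meant as $\varepsilon\to0$. Let $\varkappa_{\varepsilon j}^2\ge 0$ be coefficients with $\rho_\varepsilon^2=\sum_j\varkappa_{\varepsilon j}^2<\infty$ for every $\varepsilon>0$, and put $A_\varepsilon=\varepsilon^{-4}\sum_j\varkappa_{\varepsilon j}^4$, $k_\varepsilon=\sup\{k\ge1:\sum_{j<k}\varkappa_{\varepsilon j}^2\le\frac12\rho_\varepsilon^2\}$, $\varkappa_\varepsilon^2=\varkappa_{\varepsilon k_\varepsilon}^2$. Assume $k_\varepsilon\asymp\varepsilon^{-4+8r+4\omega}$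 and * A1: for each $\varepsilon>0$ the sequence $\varkappa_{\varepsilon j}^2$ is non-increasing in $j$; * A2: there are constants $C_1,C_2>0$ with $C_1<A_\varepsilon<C_2$ for all $\varepsilon>0$; * A3: there are $C_1>0$ and $\lambda>1$ such that $\varkappa^2_{\varepsilon,[(1+\delta)k_\varepsilon]}<C_1(1+\delta)^{-\lambda}\varkappa_\varepsilon^2$ for all $\delta>0$ and $\varepsilon>0$; * A4: $\varkappa_{\varepsilon1}^2\asymp\varkappa_\varepsilon^2$, and for every $c>1$ there is $C>0$ with $\varkappa^2_{\varepsilon,[ck_\varepsilon]}\ge C\varkappa_\varepsilon^2$ for all $\varepsilon>0$. Consider the tests $L_\varepsilon=\mathbf 1\{A_\varepsilon^{-1/2}T_\varepsilon>x_\varepsilon\}$ with $T_\varepsilon=\varepsilon^{-2}\sum_j\varkappa_{\varepsilon j}^2y_{\varepsilon j}^2-\rho_\varepsilon^2$ and arbitrary real thresholds $x_\varepsilon$; let $\alpha(L_\varepsilon)=\mathbf E_0L_\varepsilon$ and $\beta(L_\varepsilon,S)=\mathbf E_S(1-L_\varepsilon)$. A family $S_\varepsilon\in\mathbb L_2(0,1)$,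 $\varepsilon\to0$, is $\varepsilon^{-2\omega}$-LD consistent if, for every choice of thresholds with $\varepsilon^{4\omega}\log\alpha(L_\varepsilon)\to0$, there is a constant $C>0$ with $\varepsilon^{-4\omega}\le C\,|\log\beta(L_\varepsilon,S_\varepsilon)|$ for all small $\varepsilon$ (with $\log 0=-\infty$); for a sequence of alternatives observed at noise levels $\varepsilon_i\to0$ the definition is the same along the sequence. A family $S_\varepsilon$ with $\|S_\varepsilon\|\asymp\varepsilon^{2r}$ is purely $\varepsilon^{-2\omega}$-LD consistent if it is $\varepsilon^{-2\omega}$-LD consistent and there are no $\varepsilon_i>0$ with $\varepsilon_i\to0$, no $c_1>0$ and no sequence $S_{1\varepsilon_i}\in\mathbb L_2(0,1)$, not $\varepsilon_i^{-2\omega}$-LD consistent, such that for all $i$ the function $S_{1\varepsilon_i}$ is orthogonal to $S_{\varepsilon_i}-S_{1\varepsilon_i}$ and $\|S_{1\varepsilon_i}\|>c_1\varepsilon_i^{2r}$. For $P_0>0$ let $$\bar{\mathbb B}^s_{2\infty}(P_0)=\Bigl\{S=\sum_{j=1}^\infty\theta_j\phi_j:\ \sup_{\lambda>0}\lambda^{2s}\sum_{j>\lambda}\theta_j^2\le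 P_0\Bigr\}.$$ **Theorem.** Let $S_\varepsilon\in\mathbb L_2(0,1)$, $\varepsilon>0$, be a family with $\|S_\varepsilon\|\asymp\varepsilon^{2r}$. Then $S_\varepsilon$ is purely $\varepsilon^{-2\omega}$-LD consistent if and only if for every $\delta>0$ there are $P_0>0$, functions $S_{1\varepsilon}\in\bar{\mathbb B}^s_{2\infty}(P_0)$, $\varepsilon>0$, and $\varepsilon_0>0$ such that $\|S_\varepsilon-S_{1\varepsilon}\|\le\delta\varepsilon^{2r}$ for all $0<\varepsilon<\varepsilon_0$. -/

import Mathlib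

open MeasureTheory ProbabilityTheory Filter Topology Asymptotics

noncomputable section

namespace SignalDetection

/-- The Hilbert space `L₂(0,1)`. -/
abbrev L2 : Type := Lp ℝ 2 (volume.restrict (Set.Ioo (0 : ℝ) 1))

/-- The Fourier coefficient `θ_j = ∫₀¹ S φ_j dt`. -/
def coeff (φ : ℕ+ → L2) (S : L2) (j : ℕ+) : ℝ := inner ℝ (φ j) S

/-- The model `dY_ε(t) = S(t) dt + ε dw(t)` in Fourier coordinates: the law of the sequence
`y_{εj} = θ_j + ε ξ_j`, `j ≥ 1`, where the `ξ_j = ∫₀¹ φ_j dw` are independent standard Gaussian. -/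
def obsLaw (φ : ℕ+ → L2) (ε : ℝ) (S : L2) : Measure (ℕ+ → ℝ) :=
  Measure.infinitePi fun j => gaussianReal (coeff φ S j) (ε ^ 2).toNNReal

/-- `ρ² = ∑_j ϰ_j²`. -/
def rhoSq (ϰ : ℕ+ → ℝ) : ℝ := ∑' j, ϰ j ^ 2

/-- `A_ε = ε⁻⁴ ∑_j ϰ_j⁴`. -/
def bigA (ϰ : ℕ+ → ℝ) (ε : ℝ) : ℝ := ε⁻¹ ^ 4 * ∑' j, ϰ j ^ 4

/-- `k = sup {k : ∑_{j<k} ϰ_j² ≤ ρ²/2}`, the indices `k` being positive integers. -/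
def cutoff (ϰ : ℕ+ → ℝ) : ℕ :=
  sSup ((fun k : ℕ+ => (k : ℕ)) '' {k : ℕ+ | ∑ j ∈ Finset.Iio k, ϰ j ^ 2 ≤ rhoSq ϰ / 2})

/-- `ϰ²_m` for a natural number `m ≥ 1` (the value at `m = 0`, which is not used, is `ϰ²_1`). -/
def sqAt (ϰ : ℕ+ → ℝ) (m : ℕ) : ℝ := ϰ m.toPNat' ^ 2

/-- `ϰ_ε² = ϰ²_{ε, k_ε}`. -/
def cutoffSq (ϰ : ℕ+ → ℝ) : ℝ := sqAt ϰ (cutoff ϰ)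

/-- A1: for each `ε` the sequence `ϰ²_{εj}` is decreasing in `j` (not necessarily strictly). -/
def CondA1 (ϰ : ℝ → ℕ+ → ℝ) : Prop :=
  ∀ ε : ℝ, 0 < ε → Antitone fun j => ϰ ε j ^ 2

/-- A2: `C₁ < A_ε < C₂`. -/
def CondA2 (ϰ : ℝ → ℕ+ → ℝ) : Prop :=
  ∃ C₁ C₂ : ℝ, 0 < C₁ ∧ 0 < C₂ ∧ ∀ ε : ℝ, 0 < ε → C₁ < bigA (ϰ ε) ε ∧ bigA (ϰ ε) ε < C₂

/-- A3: `ϰ²_{ε,[(1+δ)k_ε]} < C₁ (1+δ)^{-λ} ϰ_ε²` for all `δ > 0` and all `ε`, with `λ > 1`. -/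
def CondA3 (ϰ : ℝ → ℕ+ → ℝ) : Prop :=
  ∃ C₁ lam : ℝ, 0 < C₁ ∧ 1 < lam ∧ ∀ δ : ℝ, 0 < δ → ∀ ε : ℝ, 0 < ε →
    sqAt (ϰ ε) ⌊(1 + δ) * (cutoff (ϰ ε) : ℝ)⌋₊ < C₁ * (1 + δ) ^ (-lam) * cutoffSq (ϰ ε)

/-- A4: `ϰ²_{ε1} ≍ ϰ_ε²` as `ε → 0`, and for every `c > 1` there is `C > 0` with
`ϰ²_{ε,[c k_ε]} ≥ C ϰ_ε²` for all `ε > 0`. -/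
def CondA4 (ϰ : ℝ → ℕ+ → ℝ) : Prop :=
  ((fun ε => ϰ ε 1 ^ 2) =Θ[𝓝[>] (0 : ℝ)] fun ε => cutoffSq (ϰ ε)) ∧
  ∀ c : ℝ, 1 < c → ∃ C : ℝ, 0 < C ∧ ∀ ε : ℝ, 0 < ε →
    C * cutoffSq (ϰ ε) ≤ sqAt (ϰ ε) ⌊c * (cutoff (ϰ ε) : ℝ)⌋₊

/-- The test statistic `T_ε = ε⁻² ∑_j ϰ²_{εj} y_j² - ρ_ε²`. -/
def stat (ϰ : ℕ+ → ℝ) (ε : ℝ) (y : ℕ+ → ℝ) : ℝ :=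
  ε⁻¹ ^ 2 * (∑' j, ϰ j ^ 2 * y j ^ 2) - rhoSq ϰ

/-- The rejection region `A_ε^{-1/2} T_ε > x` of the test `L_ε` with threshold `x`. -/
def rejectRegion (ϰ : ℕ+ → ℝ) (ε x : ℝ) : Set (ℕ+ → ℝ) :=
  {y | x < (bigA ϰ ε) ^ (-(1 / 2 : ℝ)) * stat ϰ ε y}

/-- Type I error probability `α(L_ε) = E₀ L_ε` of the test with threshold `x`. -/
def typeI (φ : ℕ+ → L2) (ϰ : ℕ+ → ℝ) (ε x : ℝ) : ℝ :=
  (obsLaw φ ε 0).real (rejectRegion ϰ ε x)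

/-- Type II error probability `β(L_ε, S) = E_S (1 - L_ε)` of the test with threshold `x`. -/
def typeII (φ : ℕ+ → L2) (ϰ : ℕ+ → ℝ) (ε x : ℝ) (S : L2) : ℝ :=
  (obsLaw φ ε S).real (rejectRegion ϰ ε x)ᶜ

/-- `R`-LD consistency of the alternatives `S i`, observed at the noise levels `e i`, along the
filter `l` (a family indexed by `ε → 0+`, or a sequence): for every choice `x` of thresholds with
`R⁻² log α → 0`, one has `|log β| = Ω(R²)`, that is `R² ≤ C |log β|` for some constant `C`
and all indices far enough along `l`. Here `log 0 = -∞`: the first condition forces `α > 0`,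
and the second one holds when `β = 0`. -/
def LDConsistentAlong {ι : Type} (φ : ℕ+ → L2) (ϰ : ℝ → ℕ+ → ℝ) (R : ℝ → ℝ)
    (l : Filter ι) (e : ι → ℝ) (S : ι → L2) : Prop :=
  ∀ x : ι → ℝ,
    (∀ᶠ i in l, 0 < typeI φ (ϰ (e i)) (e i) (x i)) →
    Tendsto (fun i => Real.log (typeI φ (ϰ (e i)) (e i) (x i)) / R (e i) ^ 2) l (𝓝 0) →
    ∃ C : ℝ, 0 < C ∧ ∀ᶠ i in l,
      typeII φ (ϰ (e i)) (e i) (x i) (S i) = 0 ∨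
        R (e i) ^ 2 ≤ C * |Real.log (typeII φ (ϰ (e i)) (e i) (x i) (S i))|

/-- `R`-LD consistency of a family `S ε`, `ε > 0`, as `ε → 0`. -/
def LDConsistent (φ : ℕ+ → L2) (ϰ : ℝ → ℕ+ → ℝ) (R : ℝ → ℝ) (S : ℝ → L2) : Prop :=
  LDConsistentAlong φ ϰ R (𝓝[>] (0 : ℝ)) (fun ε => ε) S

/-- Pure `R`-LD consistency of a family `S ε` with `‖S ε‖ ≍ ε^{2r}`: it is `R`-LD consistent, and
there is no `R`-LD inconsistent sequence `S₁ i` at noise levels `e i → 0` with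
`S₁ i ⟂ S (e i) - S₁ i` and `‖S₁ i‖ > c₁ (e i)^{2r}` for some constant `c₁ > 0`. -/
def PurelyLDConsistent (φ : ℕ+ → L2) (ϰ : ℝ → ℕ+ → ℝ) (R : ℝ → ℝ) (r : ℝ) (S : ℝ → L2) : Prop :=
  LDConsistent φ ϰ R S ∧
  ¬ ∃ (e : ℕ → ℝ) (S₁ : ℕ → L2) (c₁ : ℝ),
      (∀ i, 0 < e i) ∧ Tendsto e atTop (𝓝 0) ∧ 0 < c₁ ∧
      (∀ i, inner ℝ (S₁ i) (S (e i) - S₁ i) = 0) ∧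
      (∀ i, c₁ * e i ^ (2 * r) < ‖S₁ i‖) ∧
      ¬ LDConsistentAlong φ ϰ R atTop e S₁

/-- The ball `{S = ∑ θ_j φ_j : sup_{λ>0} λ^{2s} ∑_{j>λ} θ_j² ≤ P₀}`. -/
def besovBall (φ : ℕ+ → L2) (s P₀ : ℝ) : Set L2 :=
  {S | HasSum (fun j => coeff φ S j • φ j) S ∧
    ∀ lam : ℝ, 0 < lam →
      lam ^ (2 * s) * ∑' j : {j : ℕ+ // lam < ((j : ℕ) : ℝ)}, coeff φ S j ^ 2 ≤ P₀}

end SignalDetection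

end

/-! Write R = ε^(-2ω). The test statistic has mean `signal` = ε⁻² ∑ ϰ_j² θ_j² under S, and LD
consistency is decided by comparing this mean with ε²R.

If the signal is at least c ε²R, a threshold with log α = o(R²) must lie below η ε²R for every η >
0, and a Chernoff bound for the lower tail makes |log β| of order at least R²
(`ldConsistentAlong_of_signal_ge`). If the signal is o(ε²R), a threshold slightly above twice the
signal has log α = o(R²) by the reverse bound `le_null_tail`, while β ≥ 1/2
(`not_ldConsistentAlong_of_signal`). Both arguments tilt by a parameter of order at most ε⁻²R. This
is legitimate because R ε⁻² ϰ_j² tends to 0 uniformly in j (`weight_negligible`).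

By `exists_weight_bounds` the weights ϰ_j² have order ε^(4-4r-2ω) up to k_ε, so energy of order
ε^(4r) at frequencies up to c k_ε gives a signal of order ε²R (`signal_scale`, A4). By A3 the same
energy beyond c k_ε gives at most a multiple of c^(-λ) ε²R. Hence pure consistency means that the
energy beyond c k_ε becomes negligible for large c; this is `LowFrequency`. If it failed, the
high-frequency remainders would form an inconsistent orthogonal component. If it holds, every
orthogonal component of norm of order ε^(2r) correlates with the low frequencies of S and is
therefore detected.

Finally s is chosen so that k_ε^(2s) ε^(4r) has order 1 (`smoothness_exponent`). A bound on Besov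
tails at frequency c k_ε is thus a bound on the energy there relative to ε^(4r), and `LowFrequency`
is equivalent to approximability from the balls. -/

noncomputable section

namespace SignalDetection

/-! ### Exponential moments of a squared Gaussian -/

/-- The logarithm of `𝔼 exp (x ((μ + ξ)² - 1))` for a standard Gaussian variable `ξ`. -/
def logMGF (x μ : ℝ) : ℝ := -(1 / 2) * Real.log (1 - 2 * x) - x + x * μ ^ 2 / (1 - 2 * x)

/-- Completing the square: a quadratic tilt of a Gaussian density is again Gaussian, up to the
normalising constant. -/
lemma exp_mul_gaussianPDFReal {x : ℝ} (hx : 2 * x < 1) {ε : ℝ} (hε : 0 < ε) (θ y : ℝ) :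
    Real.exp (x * ((ε⁻¹ * y) ^ 2 - 1)) * gaussianPDFReal θ (ε ^ 2).toNNReal y =
      Real.exp (logMGF x (θ / ε)) *
        gaussianPDFReal (θ / (1 - 2 * x)) (ε ^ 2 / (1 - 2 * x)).toNNReal y := by
  have hd : 0 < 1 - 2 * x := by linarith
  have hε2 : 0 < ε ^ 2 := by positivity
  have h1 : Real.exp (-(1 / 2) * Real.log (1 - 2 * x)) = (√(1 - 2 * x))⁻¹ := by
    rw [← Real.exp_log (Real.sqrt_pos.2 hd), ← Real.exp_neg, Real.log_sqrt hd.le]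
    congr 1
    ring
  unfold gaussianPDFReal
  rw [Real.coe_toNNReal _ hε2.le, Real.coe_toNNReal _ (by positivity : 0 ≤ ε ^ 2 / (1 - 2 * x)),
    ← mul_div_assoc, Real.sqrt_div (by positivity)]
  have h2 : logMGF x (θ / ε) = -(1 / 2) * Real.log (1 - 2 * x) +
      (- x + x * (θ / ε) ^ 2 / (1 - 2 * x)) := by
    unfold logMGF; ring
  rw [h2, Real.exp_add, h1]
  have h3 : x * ((ε⁻¹ * y) ^ 2 - 1) + -(y - θ) ^ 2 / (2 * ε ^ 2) =
      (- x + x * (θ / ε) ^ 2 / (1 - 2 * x)) +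
        -(y - θ / (1 - 2 * x)) ^ 2 / (2 * (ε ^ 2 / (1 - 2 * x))) := by
    -- The denominator 1 - 2x becomes an atom, so that clearing denominators works.
    obtain ⟨d, rfl⟩ : ∃ d, x = (1 - d) / 2 := ⟨1 - 2 * x, by ring⟩
    have e : 1 - 2 * ((1 - d) / 2) = d := by ring
    rw [e] at hd ⊢
    field_simp
    ring
  calc _ = (√(2 * Real.pi * ε ^ 2))⁻¹ *
        Real.exp (x * ((ε⁻¹ * y) ^ 2 - 1) + -(y - θ) ^ 2 / (2 * ε ^ 2)) := by
        rw [Real.exp_add]; ring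
    _ = _ := by
        rw [h3, Real.exp_add]
        have : √(1 - 2 * x) ≠ 0 := (Real.sqrt_pos.2 hd).ne'
        field_simp

lemma lintegral_exp_sq_gaussianReal {x : ℝ} (hx : 2 * x < 1) {ε : ℝ} (hε : 0 < ε) (θ : ℝ) :
    ∫⁻ y, ENNReal.ofReal (Real.exp (x * ((ε⁻¹ * y) ^ 2 - 1)))
        ∂gaussianReal θ (ε ^ 2).toNNReal =
      ENNReal.ofReal (Real.exp (logMGF x (θ / ε))) := by
  have hd : 0 < 1 - 2 * x := by linarith
  have hv : (ε ^ 2).toNNReal ≠ 0 := by simpa using hε.ne'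
  have hv' : (ε ^ 2 / (1 - 2 * x)).toNNReal ≠ 0 := by
    have : 0 < ε ^ 2 / (1 - 2 * x) := by positivity
    simpa using this
  rw [gaussianReal_of_var_ne_zero _ hv, lintegral_withDensity_eq_lintegral_mul _
    (measurable_gaussianPDF _ _) (by fun_prop)]
  have : ∀ y, (gaussianPDF θ (ε ^ 2).toNNReal * fun y =>
      ENNReal.ofReal (Real.exp (x * ((ε⁻¹ * y) ^ 2 - 1)))) y =
      ENNReal.ofReal (Real.exp (logMGF x (θ / ε))) *
        gaussianPDF (θ / (1 - 2 * x)) (ε ^ 2 / (1 - 2 * x)).toNNReal y := by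
    intro y
    rw [Pi.mul_apply, gaussianPDF_def, gaussianPDF_def, ← ENNReal.ofReal_mul (gaussianPDFReal_nonneg _ _ _),
      ← ENNReal.ofReal_mul (Real.exp_pos _).le, ← exp_mul_gaussianPDFReal hx hε, mul_comm]
  simp_rw [this]
  rw [lintegral_const_mul _ (measurable_gaussianPDF _ _), lintegral_gaussianPDF_eq_one _ hv',
    mul_one]

/-- The second-order Taylor remainder is at most |z|³/(1 - |z|), and |z|/(1 - |z|) ≤ 1/3 here. -/
lemma abs_log_one_sub_le {z : ℝ} (hz : |z| ≤ 1 / 4) :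
    |z + z ^ 2 / 2 + Real.log (1 - z)| ≤ z ^ 2 / 3 := by
  have h := Real.abs_log_sub_add_sum_range_le (x := z) (by linarith) 2
  have e : ∑ i ∈ Finset.range 2, z ^ (i + 1) / ((i : ℝ) + 1) = z + z ^ 2 / 2 := by
    rw [Finset.sum_range_succ, Finset.sum_range_one]; norm_num
  rw [e] at h
  refine h.trans ?_
  rw [div_le_iff₀ (by linarith), ← sq_abs z]
  nlinarith [abs_nonneg z, mul_nonneg (sq_nonneg |z|) (sub_nonneg.2 hz)]

lemma logMGF_le_of_nonneg {x : ℝ} (h0 : 0 ≤ x) (hx : x ≤ 1 / 8) (μ : ℝ) :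
    logMGF x μ ≤ 2 * x ^ 2 + 2 * (x * μ ^ 2) := by
  have h := (abs_le.1 (abs_log_one_sub_le (z := 2 * x) (by rw [abs_of_nonneg] <;> linarith))).1
  have h2 : x * μ ^ 2 / (1 - 2 * x) ≤ 2 * (x * μ ^ 2) := by
    rw [div_le_iff₀ (by linarith)]
    nlinarith [mul_nonneg h0 (sq_nonneg μ)]
  unfold logMGF
  nlinarith

lemma logMGF_le_of_nonpos {x : ℝ} (h0 : x ≤ 0) (hx : -(1 / 8) ≤ x) (μ : ℝ) :
    logMGF x μ ≤ 2 * x ^ 2 + x * μ ^ 2 / 2 := by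
  have h := (abs_le.1 (abs_log_one_sub_le (z := 2 * x) (by rw [abs_of_nonpos] <;> linarith))).1
  have h2 : x * μ ^ 2 / (1 - 2 * x) ≤ x * μ ^ 2 / 2 := by
    rw [div_le_iff₀ (by linarith)]
    nlinarith [mul_nonneg (neg_nonneg.2 h0) (sq_nonneg μ)]
  unfold logMGF
  nlinarith

lemma le_logMGF {x : ℝ} (h0 : 0 ≤ x) (hx : x ≤ 1 / 8) : x ^ 2 / 3 ≤ logMGF x 0 := by
  have h := (abs_le.1 (abs_log_one_sub_le (z := 2 * x) (by rw [abs_of_nonneg] <;> linarith))).2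
  unfold logMGF
  simp only [ne_eq, OfNat.ofNat_ne_zero, not_false_eq_true, zero_pow, mul_zero, zero_div, add_zero]
  nlinarith

/-! ### The observation law and convergence of the test statistic -/

instance isProbabilityMeasure_obsLaw (φ : ℕ+ → L2) (ε : ℝ) (S : L2) :
    IsProbabilityMeasure (obsLaw φ ε S) := by
  unfold obsLaw; infer_instance

lemma lintegral_obsLaw_coordinate (φ : ℕ+ → L2) (ε : ℝ) (S : L2) (j : ℕ+) {f : ℝ → ENNReal}
    (hf : Measurable f) :
    ∫⁻ y, f (y j) ∂obsLaw φ ε S = ∫⁻ z, f z ∂gaussianReal (coeff φ S j) (ε ^ 2).toNNReal := by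
  unfold obsLaw
  rw [← Measure.infinitePi_map_eval
    (fun j => gaussianReal (coeff φ S j) (ε ^ 2).toNNReal) j, lintegral_map hf (by fun_prop)]

lemma lintegral_exp_sum_obsLaw (φ : ℕ+ → L2) {ε : ℝ} (hε : 0 < ε) (S : L2) (b : ℕ+ → ℝ)
    (hb : ∀ j, 2 * b j < 1) (s : Finset ℕ+) :
    ∫⁻ y, ENNReal.ofReal (Real.exp (∑ j ∈ s, b j * ((ε⁻¹ * y j) ^ 2 - 1))) ∂obsLaw φ ε S =
      ENNReal.ofReal (Real.exp (∑ j ∈ s, logMGF (b j) (coeff φ S j / ε))) := by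
  have hm : ∀ j, Measurable fun z : ℝ =>
      ENNReal.ofReal (Real.exp (b j * ((ε⁻¹ * z) ^ 2 - 1))) := fun j => by fun_prop
  have hind : iIndepFun (fun j (y : ℕ+ → ℝ) =>
      ENNReal.ofReal (Real.exp (b j * ((ε⁻¹ * y j) ^ 2 - 1)))) (obsLaw φ ε S) :=
    iIndepFun_infinitePi hm
  have h := lintegral_prod_eq_prod_lintegral_of_indepFun s _ hind
    (fun j => (hm j).comp (measurable_pi_apply j))
  simp_rw [Real.exp_sum]
  rw [ENNReal.ofReal_prod_of_nonneg fun _ _ => (Real.exp_pos _).le]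
  simp_rw [ENNReal.ofReal_prod_of_nonneg fun _ _ => (Real.exp_pos _).le]
  rw [h]
  refine Finset.prod_congr rfl fun j _ => ?_
  rw [lintegral_obsLaw_coordinate φ ε S j (hm j), lintegral_exp_sq_gaussianReal (hb j) hε]

lemma lintegral_sq_gaussianReal (m : ℝ) (v : NNReal) :
    ∫⁻ z, ENNReal.ofReal (z ^ 2) ∂gaussianReal m v = ENNReal.ofReal (m ^ 2 + v) := by
  have hL : MemLp (fun x : ℝ => x) 2 (gaussianReal m v) := memLp_id_gaussianReal 2
  have h := variance_eq_sub hL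
  rw [variance_fun_id_gaussianReal, integral_id_gaussianReal] at h
  rw [← ofReal_integral_eq_lintegral_ofReal hL.integrable_sq (ae_of_all _ fun x => sq_nonneg x)]
  congr 1
  have : ∫ x, x ^ 2 ∂gaussianReal m v = ∫ x, ((fun x : ℝ => x) ^ 2) x ∂gaussianReal m v := rfl
  rw [this]
  linarith

lemma abs_coeff_le {φ : ℕ+ → L2} (hφ : Orthonormal ℝ φ) (S : L2) (j : ℕ+) :
    |coeff φ S j| ≤ ‖S‖ := by
  simpa [coeff, hφ.1 j] using abs_real_inner_le_norm (φ j) S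

lemma summable_coeff_sq {φ : ℕ+ → L2} (hφ : Orthonormal ℝ φ) (S : L2) :
    Summable fun j => coeff φ S j ^ 2 := by
  simpa [coeff] using hφ.inner_products_summable (x := S)

lemma summable_mul_coeff_sq {φ : ℕ+ → L2} (hφ : Orthonormal ℝ φ) (S : L2) {ϰ : ℕ+ → ℝ}
    (hs : Summable fun j => ϰ j ^ 2) : Summable fun j => ϰ j ^ 2 * coeff φ S j ^ 2 := by
  refine Summable.of_nonneg_of_le (fun j => by positivity) (fun j => ?_) (hs.mul_right (‖S‖ ^ 2))
  gcongr ϰ j ^ 2 * ?_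
  rw [← sq_abs (coeff φ S j)]
  gcongr
  exact abs_coeff_le hφ S j

/-- The series has finite expectation. Hence, almost surely, the `tsum` in `stat` is a genuine sum
and not the default value 0. -/
lemma ae_summable {φ : ℕ+ → L2} (hφ : Orthonormal ℝ φ) {ε : ℝ} (S : L2) {ϰ : ℕ+ → ℝ}
    (hs : Summable fun j => ϰ j ^ 2) :
    ∀ᵐ y ∂obsLaw φ ε S, Summable fun j => ϰ j ^ 2 * y j ^ 2 := by
  have hm : ∀ j, Measurable fun y : ℕ+ → ℝ => ENNReal.ofReal (ϰ j ^ 2 * y j ^ 2) :=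
    fun j => by fun_prop
  have hfin : ∫⁻ y, ∑' j, ENNReal.ofReal (ϰ j ^ 2 * y j ^ 2) ∂obsLaw φ ε S ≠ ⊤ := by
    rw [lintegral_tsum fun j => (hm j).aemeasurable]
    have : ∀ j, ∫⁻ y, ENNReal.ofReal (ϰ j ^ 2 * y j ^ 2) ∂obsLaw φ ε S =
        ENNReal.ofReal (ϰ j ^ 2 * coeff φ S j ^ 2 + ϰ j ^ 2 * ε ^ 2) := by
      intro j
      rw [lintegral_obsLaw_coordinate φ ε S j
        (f := fun z => ENNReal.ofReal (ϰ j ^ 2 * z ^ 2)) (by fun_prop)]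
      simp_rw [ENNReal.ofReal_mul (sq_nonneg (ϰ j))]
      rw [lintegral_const_mul _ (by fun_prop), lintegral_sq_gaussianReal,
        Real.coe_toNNReal _ (sq_nonneg ε), ← ENNReal.ofReal_mul (sq_nonneg _), mul_add]
    simp_rw [this]
    rw [← ENNReal.ofReal_tsum_of_nonneg (fun j => by positivity)
      ((summable_mul_coeff_sq hφ S hs).add (hs.mul_right _))]
    exact ENNReal.ofReal_ne_top
  filter_upwards [ae_lt_top' (AEMeasurable.tsum fun j => (hm j).aemeasurable) hfin] with y hy
  have := ENNReal.summable_toReal hy.ne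
  refine this.congr fun j => ?_
  rw [ENNReal.toReal_ofReal (by positivity)]

lemma measurable_stat (ϰ : ℕ+ → ℝ) (ε : ℝ) : Measurable (stat ϰ ε) := by
  unfold stat
  exact ((Measurable.tsum fun j => by fun_prop).const_mul _).sub_const _

lemma ae_hasSum_stat {φ : ℕ+ → L2} (hφ : Orthonormal ℝ φ) {ε : ℝ} (S : L2) {ϰ : ℕ+ → ℝ}
    (hs : Summable fun j => ϰ j ^ 2) :
    ∀ᵐ y ∂obsLaw φ ε S, HasSum (fun j => ϰ j ^ 2 * ((ε⁻¹ * y j) ^ 2 - 1)) (stat ϰ ε y) := by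
  filter_upwards [ae_summable hφ S hs] with y hy
  refine ((hy.hasSum.mul_left (ε⁻¹ ^ 2)).sub hs.hasSum).congr_fun ?_
  intro j
  ring

lemma summable_pow_four {ϰ : ℕ+ → ℝ} (hs : Summable fun j => ϰ j ^ 2) :
    Summable fun j => ϰ j ^ 4 := by
  have h0 : ∀ j, ϰ j ^ 2 ≤ ∑' i, ϰ i ^ 2 := fun j => hs.le_tsum j fun i _ => sq_nonneg _
  refine Summable.of_nonneg_of_le (fun j => by positivity) (fun j => ?_)
    (hs.mul_left (∑' i, ϰ i ^ 2))
  calc ϰ j ^ 4 = ϰ j ^ 2 * ϰ j ^ 2 := by ring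
    _ ≤ _ := mul_le_mul_of_nonneg_right (h0 j) (sq_nonneg _)

/-- The signal `ε⁻² ∑_j ϰ_j² θ_j²`, the mean of the test statistic under `S`. -/
def signal (φ : ℕ+ → L2) (ϰ : ℕ+ → ℝ) (ε : ℝ) (S : L2) : ℝ :=
  ε⁻¹ ^ 2 * ∑' j, ϰ j ^ 2 * coeff φ S j ^ 2

lemma signal_nonneg (φ : ℕ+ → L2) (ϰ : ℕ+ → ℝ) (ε : ℝ) (S : L2) : 0 ≤ signal φ ϰ ε S :=
  mul_nonneg (by positivity) (tsum_nonneg fun j => by positivity)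

/-! ### Exponential moments and tail bounds of the test statistic -/

lemma tendsto_ofReal_exp {ι : Type*} {l : Filter ι} {f : ι → ℝ} {a : ℝ}
    (h : Tendsto f l (𝓝 a)) :
    Tendsto (fun i => ENNReal.ofReal (Real.exp (f i))) l (𝓝 (ENNReal.ofReal (Real.exp a))) :=
  ENNReal.tendsto_ofReal ((Real.continuous_exp.tendsto a).comp h)

/-- Fatou along finite partial sums, whose exponential moments factor by independence; no domination
is needed. -/
lemma lintegral_exp_stat_le {φ : ℕ+ → L2} (hφ : Orthonormal ℝ φ) {ε : ℝ} (hε : 0 < ε) (S : L2)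
    {ϰ : ℕ+ → ℝ} (hs : Summable fun j => ϰ j ^ 2) {t : ℝ} (ht : ∀ j, 2 * (t * ϰ j ^ 2) < 1)
    {g : ℕ+ → ℝ} {B : ℝ} (hg : HasSum g B)
    (hle : ∀ j, logMGF (t * ϰ j ^ 2) (coeff φ S j / ε) ≤ g j) :
    ∫⁻ y, ENNReal.ofReal (Real.exp (t * stat ϰ ε y)) ∂obsLaw φ ε S ≤
      ENNReal.ofReal (Real.exp B) := by
  let F : Finset ℕ+ → (ℕ+ → ℝ) → ENNReal := fun s y =>
    ENNReal.ofReal (Real.exp (∑ j ∈ s, t * ϰ j ^ 2 * ((ε⁻¹ * y j) ^ 2 - 1)))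
  have hF : ∀ s, Measurable (F s) := fun s => by fun_prop
  calc _ = ∫⁻ y, liminf (fun s => F s y) atTop ∂obsLaw φ ε S := by
        refine lintegral_congr_ae ?_
        filter_upwards [ae_hasSum_stat hφ S hs (ε := ε)] with y hy
        refine (Tendsto.liminf_eq ?_).symm
        refine tendsto_ofReal_exp (HasSum.congr_fun (hy.mul_left t) fun j => ?_)
        ring
    _ ≤ liminf (fun s => ∫⁻ y, F s y ∂obsLaw φ ε S) atTop := lintegral_liminf_le hF
    _ ≤ liminf (fun s => ENNReal.ofReal (Real.exp (∑ j ∈ s, g j))) atTop := by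
        refine liminf_le_liminf (Eventually.of_forall fun s => ?_)
        simp only [F]
        rw [lintegral_exp_sum_obsLaw φ hε S _ ht s]
        gcongr with j _
        exact hle j
    _ = _ := (tendsto_ofReal_exp hg).liminf_eq

/-- Fatou gives only the other direction. Dropping the nonnegative terms ϰ_j² y_j² outside a finite
set leaves the finite sum minus t times the tail of ρ², and this loss vanishes in the limit. -/
lemma le_lintegral_exp_stat {φ : ℕ+ → L2} (hφ : Orthonormal ℝ φ) {ε : ℝ} (hε : 0 < ε) (S : L2)
    {ϰ : ℕ+ → ℝ} (hs : Summable fun j => ϰ j ^ 2) {t : ℝ} (ht0 : 0 ≤ t)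
    (ht : ∀ j, 2 * (t * ϰ j ^ 2) < 1) {g : ℕ+ → ℝ} {B : ℝ} (hg : HasSum g B)
    (hle : ∀ j, g j ≤ logMGF (t * ϰ j ^ 2) (coeff φ S j / ε)) :
    ENNReal.ofReal (Real.exp B) ≤
      ∫⁻ y, ENNReal.ofReal (Real.exp (t * stat ϰ ε y)) ∂obsLaw φ ε S := by
  have hlim : Tendsto (fun s => -(t * (rhoSq ϰ - ∑ j ∈ s, ϰ j ^ 2)) + ∑ j ∈ s, g j) atTop
      (𝓝 B) := by
    have h : Tendsto (fun s => -(t * (rhoSq ϰ - ∑ j ∈ s, ϰ j ^ 2)) + ∑ j ∈ s, g j) atTop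
        (𝓝 (-(t * (rhoSq ϰ - rhoSq ϰ)) + B)) :=
      ((tendsto_const_nhds.sub hs.hasSum).const_mul t).neg.add hg
    simpa using h
  refine le_of_tendsto (tendsto_ofReal_exp hlim) (Eventually.of_forall fun s => ?_)
  rw [Real.exp_add, ENNReal.ofReal_mul (Real.exp_pos _).le]
  calc _ ≤ ENNReal.ofReal (Real.exp (-(t * (rhoSq ϰ - ∑ j ∈ s, ϰ j ^ 2)))) *
        ∫⁻ y, ENNReal.ofReal (Real.exp (∑ j ∈ s, t * ϰ j ^ 2 * ((ε⁻¹ * y j) ^ 2 - 1)))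
          ∂obsLaw φ ε S := by
        rw [lintegral_exp_sum_obsLaw φ hε S _ ht s]
        gcongr with j _
        exact hle j
    _ = ∫⁻ y, ENNReal.ofReal (Real.exp (-(t * (rhoSq ϰ - ∑ j ∈ s, ϰ j ^ 2)))) *
          ENNReal.ofReal (Real.exp (∑ j ∈ s, t * ϰ j ^ 2 * ((ε⁻¹ * y j) ^ 2 - 1)))
          ∂obsLaw φ ε S := by
        rw [lintegral_const_mul _ (by fun_prop)]
    _ ≤ _ := by
        refine lintegral_mono_ae ?_
        filter_upwards [ae_summable hφ S hs (ε := ε)] with y hy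
        rw [← ENNReal.ofReal_mul (Real.exp_pos _).le, ← Real.exp_add]
        refine ENNReal.ofReal_le_ofReal (Real.exp_le_exp.2 ?_)
        have h1 : ∑ j ∈ s, ϰ j ^ 2 * y j ^ 2 ≤ ∑' j, ϰ j ^ 2 * y j ^ 2 :=
          hy.sum_le_tsum s fun j _ => by positivity
        have h2 : ∑ j ∈ s, t * ϰ j ^ 2 * ((ε⁻¹ * y j) ^ 2 - 1) =
            t * (ε⁻¹ ^ 2 * ∑ j ∈ s, ϰ j ^ 2 * y j ^ 2 - ∑ j ∈ s, ϰ j ^ 2) := by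
          rw [Finset.mul_sum, ← Finset.sum_sub_distrib, Finset.mul_sum]
          exact Finset.sum_congr rfl fun j _ => by ring
        rw [h2, stat, ← mul_neg, ← mul_add]
        refine mul_le_mul_of_nonneg_left ?_ ht0
        have := mul_le_mul_of_nonneg_left h1 (by positivity : 0 ≤ ε⁻¹ ^ 2)
        linarith

lemma hasSum_logMGF_bound {φ : ℕ+ → L2} (hφ : Orthonormal ℝ φ) (ε : ℝ) (S : L2) {ϰ : ℕ+ → ℝ}
    (hs : Summable fun j => ϰ j ^ 2) (t c : ℝ) :
    HasSum (fun j => 2 * (t * ϰ j ^ 2) ^ 2 + c * (t * ϰ j ^ 2 * (coeff φ S j / ε) ^ 2))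
      (2 * t ^ 2 * ∑' j, ϰ j ^ 4 + c * t * signal φ ϰ ε S) := by
  have h1 := (summable_pow_four hs).hasSum.mul_left (2 * t ^ 2)
  have h2 := (summable_mul_coeff_sq hφ S hs).hasSum.mul_left (c * t * ε⁻¹ ^ 2)
  unfold signal
  rw [← mul_assoc (c * t)]
  refine (h1.add h2).congr_fun fun j => ?_
  ring

lemma lintegral_exp_stat_le_of_nonneg {φ : ℕ+ → L2} (hφ : Orthonormal ℝ φ) {ε : ℝ} (hε : 0 < ε)
    (S : L2) {ϰ : ℕ+ → ℝ} (hs : Summable fun j => ϰ j ^ 2) {t : ℝ} (ht0 : 0 ≤ t)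
    (ht : ∀ j, t * ϰ j ^ 2 ≤ 1 / 8) :
    ∫⁻ y, ENNReal.ofReal (Real.exp (t * stat ϰ ε y)) ∂obsLaw φ ε S ≤
      ENNReal.ofReal (Real.exp (2 * t ^ 2 * ∑' j, ϰ j ^ 4 + 2 * t * signal φ ϰ ε S)) := by
  refine lintegral_exp_stat_le hφ hε S hs (fun j => ?_) (hasSum_logMGF_bound hφ ε S hs t 2)
    fun j => logMGF_le_of_nonneg (by positivity) (ht j) _
  linarith [ht j]

lemma lintegral_exp_neg_stat_le {φ : ℕ+ → L2} (hφ : Orthonormal ℝ φ) {ε : ℝ} (hε : 0 < ε)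
    (S : L2) {ϰ : ℕ+ → ℝ} (hs : Summable fun j => ϰ j ^ 2) {t : ℝ} (ht0 : 0 ≤ t)
    (ht : ∀ j, t * ϰ j ^ 2 ≤ 1 / 8) :
    ∫⁻ y, ENNReal.ofReal (Real.exp (-t * stat ϰ ε y)) ∂obsLaw φ ε S ≤
      ENNReal.ofReal (Real.exp (2 * t ^ 2 * ∑' j, ϰ j ^ 4 - t / 2 * signal φ ϰ ε S)) := by
  have h := hasSum_logMGF_bound hφ ε S hs (-t) (1 / 2)
  have e : 2 * (-t) ^ 2 * ∑' j, ϰ j ^ 4 + 1 / 2 * -t * signal φ ϰ ε S =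
      2 * t ^ 2 * ∑' j, ϰ j ^ 4 - t / 2 * signal φ ϰ ε S := by ring
  rw [e] at h
  have hn : ∀ j, 0 ≤ t * ϰ j ^ 2 := fun j => by positivity
  refine lintegral_exp_stat_le hφ hε S hs (fun j => ?_) h fun j => ?_
  · linarith [hn j]
  · refine (logMGF_le_of_nonpos (by linarith [hn j]) (by linarith [ht j]) _).trans (le_of_eq ?_)
    ring

lemma le_lintegral_exp_stat_null {φ : ℕ+ → L2} (hφ : Orthonormal ℝ φ) {ε : ℝ} (hε : 0 < ε)
    {ϰ : ℕ+ → ℝ} (hs : Summable fun j => ϰ j ^ 2) {t : ℝ} (ht0 : 0 ≤ t)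
    (ht : ∀ j, t * ϰ j ^ 2 ≤ 1 / 8) :
    ENNReal.ofReal (Real.exp (t ^ 2 / 3 * ∑' j, ϰ j ^ 4)) ≤
      ∫⁻ y, ENNReal.ofReal (Real.exp (t * stat ϰ ε y)) ∂obsLaw φ ε 0 := by
  refine le_lintegral_exp_stat hφ hε 0 hs ht0 (fun j => by linarith [ht j])
    ((summable_pow_four hs).hasSum.mul_left (t ^ 2 / 3)) fun j => ?_
  have h := le_logMGF (by positivity) (ht j)
  have e : coeff φ 0 j / ε = 0 := by simp [coeff]
  rw [e]
  exact (le_of_eq (by ring)).trans h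

lemma measureReal_le_of_lintegral_exp_le {Ω : Type*} [MeasurableSpace Ω] {μ : Measure Ω}
    {X : Ω → ℝ} (hX : Measurable X) {B u : ℝ}
    (h : ∫⁻ y, ENNReal.ofReal (Real.exp (X y)) ∂μ ≤ ENNReal.ofReal (Real.exp B)) :
    μ.real {y | u ≤ X y} ≤ Real.exp (B - u) := by
  have h1 := mul_meas_ge_le_lintegral (μ := μ)
    (f := fun y => ENNReal.ofReal (Real.exp (X y))) (by fun_prop) (ENNReal.ofReal (Real.exp u))
  have e : {y | ENNReal.ofReal (Real.exp u) ≤ ENNReal.ofReal (Real.exp (X y))} =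
      {y | u ≤ X y} := by
    ext y
    simp only [Set.mem_ofPred_eq]
    rw [ENNReal.ofReal_le_ofReal_iff (Real.exp_pos _).le, Real.exp_le_exp]
  rw [e] at h1
  have h2 := ENNReal.toReal_mono ENNReal.ofReal_ne_top (h1.trans h)
  rw [ENNReal.toReal_mul, ENNReal.toReal_ofReal (Real.exp_pos _).le,
    ENNReal.toReal_ofReal (Real.exp_pos _).le] at h2
  rw [Real.exp_sub, le_div_iff₀ (Real.exp_pos _), mul_comm]
  exact h2

/-- Chernoff bound for the upper tail of the test statistic. -/
lemma upper_tail_le {φ : ℕ+ → L2} (hφ : Orthonormal ℝ φ) {ε : ℝ} (hε : 0 < ε)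
    (S : L2) {ϰ : ℕ+ → ℝ} (hs : Summable fun j => ϰ j ^ 2) {t : ℝ} (ht0 : 0 ≤ t)
    (ht : ∀ j, t * ϰ j ^ 2 ≤ 1 / 8) (u : ℝ) :
    (obsLaw φ ε S).real {y | u < stat ϰ ε y} ≤
      Real.exp (2 * t ^ 2 * ∑' j, ϰ j ^ 4 + 2 * t * signal φ ϰ ε S - t * u) := by
  refine le_trans (measureReal_mono ?_) (measureReal_le_of_lintegral_exp_le
    ((measurable_stat ϰ ε).const_mul t) (lintegral_exp_stat_le_of_nonneg hφ hε S hs ht0 ht))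
  exact fun y hy => mul_le_mul_of_nonneg_left (le_of_lt hy) ht0

/-- Chernoff bound for the lower tail of the test statistic. -/
lemma lower_tail_le {φ : ℕ+ → L2} (hφ : Orthonormal ℝ φ) {ε : ℝ} (hε : 0 < ε)
    (S : L2) {ϰ : ℕ+ → ℝ} (hs : Summable fun j => ϰ j ^ 2) {t : ℝ} (ht0 : 0 ≤ t)
    (ht : ∀ j, t * ϰ j ^ 2 ≤ 1 / 8) (u : ℝ) :
    (obsLaw φ ε S).real {y | stat ϰ ε y ≤ u} ≤
      Real.exp (2 * t ^ 2 * ∑' j, ϰ j ^ 4 - t / 2 * signal φ ϰ ε S + t * u) := by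
  have h := measureReal_le_of_lintegral_exp_le (u := -t * u)
    ((measurable_stat ϰ ε).const_mul (-t)) (lintegral_exp_neg_stat_le hφ hε S hs ht0 ht)
  refine le_trans (measureReal_mono ?_) (h.trans (le_of_eq ?_))
  · intro y hy
    simp only [Set.mem_ofPred_eq, neg_mul, neg_le_neg_iff] at hy ⊢
    exact mul_le_mul_of_nonneg_left hy ht0
  · congr 1; ring

/-- Split at the level u and apply Cauchy–Schwarz on {u < X}. Read backwards, a large exponential
moment at t and a controlled one at 2t force the tail probability to be large. -/
lemma lintegral_exp_le_add {Ω : Type*} [MeasurableSpace Ω] {μ : Measure Ω}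
    [IsProbabilityMeasure μ] {X : Ω → ℝ} (hX : Measurable X) {t u B : ℝ} (ht : 0 ≤ t)
    (h : ∫⁻ y, ENNReal.ofReal (Real.exp (2 * t * X y)) ∂μ ≤ ENNReal.ofReal (Real.exp (2 * B))) :
    ∫⁻ y, ENNReal.ofReal (Real.exp (t * X y)) ∂μ ≤
      ENNReal.ofReal (Real.exp (t * u) + Real.exp B * √(μ.real {y | u < X y})) := by
  set E : Set Ω := {y | u < X y} with hE
  have hEm : MeasurableSet E := measurableSet_lt measurable_const hX
  have hm : Measurable fun y => ENNReal.ofReal (Real.exp (t * X y)) := by fun_prop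
  rw [← lintegral_add_compl _ hEm, add_comm, ENNReal.ofReal_add (Real.exp_pos _).le
    (by positivity)]
  refine add_le_add ?_ ?_
  · calc _ ≤ ∫⁻ y in Eᶜ, ENNReal.ofReal (Real.exp (t * u)) ∂μ := by
          refine setLIntegral_mono measurable_const fun y hy => ?_
          have : X y ≤ u := not_lt.1 hy
          gcongr
      _ = ENNReal.ofReal (Real.exp (t * u)) * μ Eᶜ := setLIntegral_const _ _
      _ ≤ _ := mul_le_of_le_one_right' prob_le_one
  · have hH := ENNReal.lintegral_mul_le_Lp_mul_Lq (μ.restrict E) Real.HolderConjugate.two_two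
      hm.aemeasurable (measurable_const (a := (1 : ENNReal))).aemeasurable
    simp only [Pi.mul_apply, mul_one, ENNReal.one_rpow, lintegral_const, one_mul,
      Measure.restrict_apply MeasurableSet.univ, Set.univ_inter] at hH
    refine hH.trans ?_
    rw [ENNReal.ofReal_mul (Real.exp_pos _).le, Real.sqrt_eq_rpow,
      ← ENNReal.ofReal_rpow_of_nonneg measureReal_nonneg (by norm_num), ofReal_measureReal]
    refine mul_le_mul_left ?_ _
    have e1 : Real.exp B = Real.exp (2 * B) ^ (1 / 2 : ℝ) := by
      rw [← Real.exp_mul]; congr 1; ring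
    rw [e1, ← ENNReal.ofReal_rpow_of_nonneg (Real.exp_pos _).le (by norm_num)]
    refine ENNReal.rpow_le_rpow ((setLIntegral_le_lintegral _ _).trans (le_trans (le_of_eq ?_) h))
      (by norm_num)
    refine lintegral_congr fun y => ?_
    rw [ENNReal.ofReal_rpow_of_nonneg (Real.exp_pos _).le (by norm_num), ← Real.exp_mul]
    congr 2; ring

/-- Moderate deviation lower bound for the test statistic under the null hypothesis. -/
lemma le_null_tail {φ : ℕ+ → L2} (hφ : Orthonormal ℝ φ) {ε : ℝ} (hε : 0 < ε)
    {ϰ : ℕ+ → ℝ} (hs : Summable fun j => ϰ j ^ 2) (ha : 0 < ∑' j, ϰ j ^ 4) {u : ℝ} (hu0 : 0 ≤ u)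
    (hu : ∀ j, 12 * u / (∑' j, ϰ j ^ 4) * ϰ j ^ 2 ≤ 1 / 8)
    (hu1 : 1 / 2 ≤ u ^ 2 / ∑' j, ϰ j ^ 4) :
    Real.exp (-288 * (u ^ 2 / ∑' j, ϰ j ^ 4)) ≤ (obsLaw φ ε 0).real {y | u < stat ϰ ε y} := by
  set a := ∑' j, ϰ j ^ 4 with ha'
  set v := u ^ 2 / a with hv
  -- With this t the moment is at least exp(12v), while the part below u contributes at most exp(tu)
  -- = exp(6v). The moment at 2t is at most exp(288v), which is the source of the constant 288.
  set t := 6 * u / a with ht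
  have ht0 : 0 ≤ t := by positivity
  have h2t : ∀ j, 2 * t * ϰ j ^ 2 ≤ 1 / 8 := fun j => by
    refine le_trans (le_of_eq ?_) (hu j); rw [ht]; ring
  have h1t : ∀ j, t * ϰ j ^ 2 ≤ 1 / 8 := fun j => by
    have : 0 ≤ t * ϰ j ^ 2 := by positivity
    linarith [h2t j]
  have eU : 2 * (2 * t) ^ 2 * ∑' j, ϰ j ^ 4 + 2 * (2 * t) * signal φ ϰ ε 0 = 2 * (144 * v) := by
    have : signal φ ϰ ε 0 = 0 := by simp [signal, coeff]
    rw [this, ← ha', ht, hv]; field_simp; ring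
  have hU := lintegral_exp_stat_le_of_nonneg hφ hε 0 hs (t := 2 * t) (by positivity) h2t
  rw [eU] at hU
  have hL := le_lintegral_exp_stat_null hφ hε hs ht0 h1t
  have eL : t ^ 2 / 3 * ∑' j, ϰ j ^ 4 = 12 * v := by
    rw [← ha', ht, hv]; field_simp; ring
  rw [eL] at hL
  have h := hL.trans (lintegral_exp_le_add (measurable_stat ϰ ε) ht0 (u := u) hU)
  rw [ENNReal.ofReal_le_ofReal_iff (by positivity)] at h
  have etu : t * u = 6 * v := by rw [ht, hv]; ring
  rw [etu] at h
  set p := (obsLaw φ ε 0).real {y | u < stat ϰ ε y}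
  have h6 : 1 + 6 * v ≤ Real.exp (6 * v) := by linarith [Real.add_one_le_exp (6 * v)]
  have h12 : Real.exp (12 * v) = Real.exp (6 * v) * Real.exp (6 * v) := by
    rw [← Real.exp_add]; congr 1; ring
  -- Since v ≥ 1/2, exp(6v) ≥ 4, so exp(12v) - exp(6v) ≥ 1.
  have h1 : 1 ≤ Real.exp (144 * v) * √p := by nlinarith
  have h2 : Real.exp (-(144 * v)) ≤ √p := by
    rw [Real.exp_neg, inv_le_iff_one_le_mul₀' (Real.exp_pos _)]; exact h1
  have h3 := (Real.le_sqrt' (Real.exp_pos _)).1 h2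
  rw [← Real.exp_nat_mul] at h3
  refine le_trans (le_of_eq ?_) h3
  congr 1; push_cast; ring

/-! ### Error probabilities of the tests -/

lemma rejectRegion_eq {ϰ : ℕ+ → ℝ} {ε : ℝ} (hA : 0 < bigA ϰ ε) (x : ℝ) :
    rejectRegion ϰ ε x = {y | √(bigA ϰ ε) * x < stat ϰ ε y} := by
  have hs : 0 < √(bigA ϰ ε) := Real.sqrt_pos.2 hA
  ext y
  simp only [rejectRegion, Set.mem_ofPred_eq]
  rw [Real.rpow_neg hA.le, ← Real.sqrt_eq_rpow, inv_mul_eq_div, lt_div_iff₀' hs]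

lemma typeI_eq (φ : ℕ+ → L2) {ϰ : ℕ+ → ℝ} {ε : ℝ} (hA : 0 < bigA ϰ ε) (x : ℝ) :
    typeI φ ϰ ε x = (obsLaw φ ε 0).real {y | √(bigA ϰ ε) * x < stat ϰ ε y} := by
  rw [typeI, rejectRegion_eq hA]

lemma typeII_eq (φ : ℕ+ → L2) {ϰ : ℕ+ → ℝ} {ε : ℝ} (hA : 0 < bigA ϰ ε) (x : ℝ) (S : L2) :
    typeII φ ϰ ε x S = (obsLaw φ ε S).real {y | stat ϰ ε y ≤ √(bigA ϰ ε) * x} := by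
  rw [typeII, rejectRegion_eq hA]
  congr 1
  ext y
  simp

lemma tsum_pow_four_eq (ϰ : ℕ+ → ℝ) {ε : ℝ} (hε : 0 < ε) :
    ∑' j, ϰ j ^ 4 = ε ^ 4 * bigA ϰ ε := by
  unfold bigA
  field_simp

lemma signal_zero (φ : ℕ+ → L2) (ϰ : ℕ+ → ℝ) (ε : ℝ) : signal φ ϰ ε 0 = 0 := by
  simp [signal, coeff]

/-- The tilt is t = τ ε⁻²; in this scale ∑ ϰ_j⁴ = ε⁴ A_ε turns into the bounded quantity A_ε. -/
lemma typeI_le {φ : ℕ+ → L2} (hφ : Orthonormal ℝ φ) {ε : ℝ} (hε : 0 < ε)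
    {ϰ : ℕ+ → ℝ} (hs : Summable fun j => ϰ j ^ 2) (hA : 0 < bigA ϰ ε) {τ : ℝ} (hτ : 0 ≤ τ)
    (ht : ∀ j, τ * (ε⁻¹ ^ 2 * ϰ j ^ 2) ≤ 1 / 8) (x : ℝ) :
    typeI φ ϰ ε x ≤
      Real.exp (2 * τ ^ 2 * bigA ϰ ε - τ * (√(bigA ϰ ε) * (ε⁻¹ ^ 2 * x))) := by
  rw [typeI_eq φ hA]
  refine (upper_tail_le hφ hε 0 hs (t := τ * ε⁻¹ ^ 2) (by positivity)
    (fun j => (le_of_eq (by ring)).trans (ht j)) _).trans (le_of_eq ?_)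
  rw [signal_zero, tsum_pow_four_eq ϰ hε]
  congr 1
  field_simp
  ring

lemma typeII_le {φ : ℕ+ → L2} (hφ : Orthonormal ℝ φ) {ε : ℝ} (hε : 0 < ε) (S : L2)
    {ϰ : ℕ+ → ℝ} (hs : Summable fun j => ϰ j ^ 2) (hA : 0 < bigA ϰ ε) {τ : ℝ} (hτ : 0 ≤ τ)
    (ht : ∀ j, τ * (ε⁻¹ ^ 2 * ϰ j ^ 2) ≤ 1 / 8) (x : ℝ) :
    typeII φ ϰ ε x S ≤
      Real.exp (2 * τ ^ 2 * bigA ϰ ε - τ / 2 * (ε⁻¹ ^ 2 * signal φ ϰ ε S) +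
        τ * (√(bigA ϰ ε) * (ε⁻¹ ^ 2 * x))) := by
  rw [typeII_eq φ hA]
  refine (lower_tail_le hφ hε S hs (t := τ * ε⁻¹ ^ 2) (by positivity)
    (fun j => (le_of_eq (by ring)).trans (ht j)) _).trans (le_of_eq ?_)
  rw [tsum_pow_four_eq ϰ hε]
  congr 1
  field_simp

/-! ### Signal strength decides LD consistency -/

section LargeDeviations

variable {φ : ℕ+ → L2} {ϰ : ℝ → ℕ+ → ℝ} {R : ℝ → ℝ} {ι : Type} {l : Filter ι} {e : ι → ℝ}
  {S : ι → L2}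

/-- Alternatives whose signal is at least of the order `ε² R` are LD consistent. -/
lemma ldConsistentAlong_of_signal_ge (hφ : Orthonormal ℝ φ)
    (hsum : ∀ ε : ℝ, 0 < ε → Summable fun j => ϰ ε j ^ 2) (hA2 : CondA2 ϰ)
    (hR : ∀ᶠ ε in 𝓝[>] (0 : ℝ), 0 < R ε)
    (hK : ∀ η : ℝ, 0 < η → ∀ᶠ ε in 𝓝[>] (0 : ℝ), ∀ j, R ε * (ε⁻¹ ^ 2 * ϰ ε j ^ 2) ≤ η)
    (he : Tendsto e l (𝓝[>] (0 : ℝ))) {c : ℝ} (hc : 0 < c)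
    (hsig : ∀ᶠ i in l, c * (e i ^ 2 * R (e i)) ≤ signal φ (ϰ (e i)) (e i) (S i)) :
    LDConsistentAlong φ ϰ R l e S := by
  obtain ⟨C₁, C₂, hC₁, hC₂, hA⟩ := hA2
  intro x hpos hlim
  -- D bounds both A_ε and √A_ε.
  set D := C₂ + 1 with hD
  have hD0 : 0 < D := by linarith
  set s := √C₁ with hs
  have hs0 : 0 < s := Real.sqrt_pos.2 hC₁
  -- In the exponent of β at tilt lam R, the signal contributes at most -lam c R²/2. These lam and η
  -- keep the quadratic and the threshold terms below lam c R²/8 each, leaving -lam c R²/4.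
  set lam := c / (16 * D) with hlam
  set η := c / (8 * D) with hη
  have hη0 : 0 < η := by positivity
  have hlam0 : 0 < lam := by positivity
  -- With this m the quadratic Chernoff term is at most half of the linear one. A threshold of at
  -- least η ε²R would then give log α ≤ -(m s η/2) R², against log α = o(R²).
  set m := s * η / (4 * D) with hm
  have hm0 : 0 < m := by positivity
  have hlow : ∀ᶠ i in l, -(m * s * η / 2) <
      Real.log (typeI φ (ϰ (e i)) (e i) (x i)) / R (e i) ^ 2 :=
    hlim.eventually_const_lt (by simp; positivity)
  have hKm := he.eventually (hK (1 / (8 * m)) (by positivity))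
  have hKl := he.eventually (hK (1 / (8 * lam)) (by positivity))
  have hε := he.eventually self_mem_nhdsWithin
  refine ⟨4 / (lam * c), by positivity, ?_⟩
  filter_upwards [hpos, hlow, hKm, hKl, hε, he.eventually hR, hsig] with
    i hpos hlow hKm hKl (hε : 0 < e i) hR hsig
  obtain ⟨hA1, hA2⟩ := hA (e i) hε
  set A := bigA (ϰ (e i)) (e i)
  have hA0 : 0 < A := by linarith
  have hsA : s ≤ √A := Real.sqrt_le_sqrt hA1.le
  have hAD : √A ≤ D := by
    rw [Real.sqrt_le_left hD0.le]; nlinarith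
  set ρ := R (e i)
  set z := (e i)⁻¹ ^ 2 * x i with hz
  have hx : z < η * ρ := by
    by_contra! hcon
    have h1 := typeI_le hφ hε (hsum _ hε) hA0 (τ := m * ρ) (by positivity) (fun j => by
      have := mul_le_mul_of_nonneg_left (hKm j) hm0.le
      calc _ = m * (ρ * ((e i)⁻¹ ^ 2 * ϰ (e i) j ^ 2)) := by ring
        _ ≤ _ := this
        _ = 1 / 8 := by field_simp) (x i)
    have h2 := (Real.log_le_iff_le_exp hpos).2 h1
    have h3 : s * (η * ρ) ≤ √A * z :=
      mul_le_mul hsA hcon (by positivity) (by positivity)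
    have h4 : m * ρ * (s * (η * ρ)) ≤ m * ρ * (√A * z) :=
      mul_le_mul_of_nonneg_left h3 (by positivity)
    have h5 : 2 * (m * ρ) ^ 2 * A ≤ m * ρ ^ 2 * (s * η / 2) := by
      calc _ ≤ 2 * (m * ρ) ^ 2 * D := by gcongr; linarith
        _ = m * ρ ^ 2 * (2 * (m * D)) := by ring
        _ = _ := by rw [hm]; field_simp; ring
    rw [lt_div_iff₀ (by positivity)] at hlow
    nlinarith
  have h1 := typeII_le hφ hε (S i) (hsum _ hε) hA0 (τ := lam * ρ) (by positivity) (fun j => by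
    have := mul_le_mul_of_nonneg_left (hKl j) hlam0.le
    calc _ = lam * (ρ * ((e i)⁻¹ ^ 2 * ϰ (e i) j ^ 2)) := by ring
      _ ≤ _ := this
      _ = 1 / 8 := by field_simp) (x i)
  have hβ : 0 ≤ typeII φ (ϰ (e i)) (e i) (x i) (S i) := measureReal_nonneg
  rcases eq_or_lt_of_le hβ with h0 | h0
  · exact Or.inl h0.symm
  right
  have h2 : Real.log (typeII φ (ϰ (e i)) (e i) (x i) (S i)) ≤ 2 * (lam * ρ) ^ 2 * A -
      lam * ρ / 2 * ((e i)⁻¹ ^ 2 * signal φ (ϰ (e i)) (e i) (S i)) + lam * ρ * (√A * z) :=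
    (Real.log_le_iff_le_exp h0).2 h1
  have h3 : c * ρ ≤ (e i)⁻¹ ^ 2 * signal φ (ϰ (e i)) (e i) (S i) := by
    calc c * ρ = (e i)⁻¹ ^ 2 * (c * (e i ^ 2 * ρ)) := by field_simp
      _ ≤ _ := mul_le_mul_of_nonneg_left hsig (by positivity)
  have h4 : √A * z ≤ c / 8 * ρ := by
    calc √A * z ≤ √A * (η * ρ) := mul_le_mul_of_nonneg_left hx.le (by positivity)
      _ ≤ D * (η * ρ) := by gcongr
      _ = _ := by rw [hη]; field_simp
  have h5 : 2 * (lam * ρ) ^ 2 * A ≤ lam * ρ * (c / 8 * ρ) := by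
    calc _ ≤ 2 * (lam * ρ) ^ 2 * D := by gcongr; linarith
      _ = lam * ρ * (2 * lam * D * ρ) := by ring
      _ = _ := by rw [hlam]; field_simp; ring
  have h6 := mul_le_mul_of_nonneg_left h3 (by positivity : 0 ≤ lam * ρ / 2)
  have h7 := mul_le_mul_of_nonneg_left h4 (by positivity : 0 ≤ lam * ρ)
  have h8 : Real.log (typeII φ (ϰ (e i)) (e i) (x i) (S i)) ≤ -(lam * c / 4 * ρ ^ 2) := by
    linarith
  have h9 := (neg_le_neg h8).trans (neg_le_abs _)
  rw [neg_neg] at h9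
  calc ρ ^ 2 = 4 / (lam * c) * (lam * c / 4 * ρ ^ 2) := by field_simp
    _ ≤ _ := mul_le_mul_of_nonneg_left h9 (by positivity)

/-- Alternatives whose signal is of smaller order than `ε² R` are not LD consistent. -/
lemma not_ldConsistentAlong_of_signal [l.NeBot] (hφ : Orthonormal ℝ φ)
    (hsum : ∀ ε : ℝ, 0 < ε → Summable fun j => ϰ ε j ^ 2) (hA2 : CondA2 ϰ)
    (hR : Tendsto R (𝓝[>] (0 : ℝ)) atTop)
    (hK : ∀ η : ℝ, 0 < η → ∀ᶠ ε in 𝓝[>] (0 : ℝ), ∀ j, R ε * (ε⁻¹ ^ 2 * ϰ ε j ^ 2) ≤ η)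
    (he : Tendsto e l (𝓝[>] (0 : ℝ)))
    (hsig : Tendsto (fun i => signal φ (ϰ (e i)) (e i) (S i) / (e i ^ 2 * R (e i))) l (𝓝 0)) :
    ¬ LDConsistentAlong φ ϰ R l e S := by
  obtain ⟨C₁, C₂, hC₁, hC₂, hA⟩ := hA2
  -- The upper tail bound at tilt ε⁻² and level 2 signal + M ε² is exp(2A - M) ≤ exp(-1) ≤ 1/2. The
  -- term M ε² also secures u²/∑ ϰ_j⁴ ≥ 1/2, as `le_null_tail` requires.
  set M := 2 * C₂ + 1 with hM
  have hM0 : 0 < M := by linarith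
  have hRe : Tendsto (fun i => R (e i)) l atTop := hR.comp he
  set w : ι → ℝ := fun i => 2 * (signal φ (ϰ (e i)) (e i) (S i) / (e i ^ 2 * R (e i))) +
    M / R (e i) with hw
  have hwlim : Tendsto w l (𝓝 0) := by
    simpa using (hsig.const_mul 2).add (hRe.const_div_atTop M)
  set u : ι → ℝ := fun i => 2 * signal φ (ϰ (e i)) (e i) (S i) + M * e i ^ 2 with hu
  set x : ι → ℝ := fun i => u i / √(bigA (ϰ (e i)) (e i)) with hx
  -- The bound 1/8 admits the tilt ε⁻²; C₁/96 gives the tilt condition of `le_null_tail`, since u =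
  -- ε²R w with w ≤ 1 and A_ε > C₁.
  have hKb := he.eventually (hK (min (1 / 8) (C₁ / 96)) (by positivity))
  have hε := he.eventually self_mem_nhdsWithin
  have key : ∀ᶠ i in l, 0 < typeI φ (ϰ (e i)) (e i) (x i) ∧
      -(288 / C₁ * w i ^ 2) ≤ Real.log (typeI φ (ϰ (e i)) (e i) (x i)) / R (e i) ^ 2 ∧
      Real.log (typeI φ (ϰ (e i)) (e i) (x i)) / R (e i) ^ 2 ≤ 0 ∧
      1 / 2 ≤ typeII φ (ϰ (e i)) (e i) (x i) (S i) := by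
    filter_upwards [hKb, hε, hRe.eventually_ge_atTop 1, hwlim.eventually_le_const one_pos] with
      i hKb (hε : 0 < e i) hR1 hw1
    obtain ⟨hA1, hA2⟩ := hA (e i) hε
    have hsum := hsum _ hε
    have ha := tsum_pow_four_eq (ϰ (e i)) hε
    set A := bigA (ϰ (e i)) (e i) with hAdef
    have hA0 : 0 < A := by linarith
    have hsA : 0 < √A := Real.sqrt_pos.2 hA0
    set ρ := R (e i) with hρ
    have hρ0 : 0 < ρ := by linarith
    have hsn := signal_nonneg φ (ϰ (e i)) (e i) (S i)
    have hxu : √A * x i = u i := mul_div_cancel₀ _ hsA.ne'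
    have huw : u i = e i ^ 2 * ρ * w i := by simp only [hu, hw, ← hρ]; field_simp
    have huM : M * e i ^ 2 ≤ u i := by simp only [hu]; linarith
    have hu0 : 0 ≤ u i := le_trans (by positivity) huM
    have hα := le_null_tail hφ hε hsum (by rw [ha]; positivity) hu0 (fun j => by
      have h1 := (hKb j).trans (min_le_right _ _)
      rw [ha, huw]
      calc _ = 12 * (w i / A) * (ρ * ((e i)⁻¹ ^ 2 * ϰ (e i) j ^ 2)) := by field_simp
        _ ≤ 12 * (1 / C₁) * (C₁ / 96) := by gcongr
        _ = 1 / 8 := by field_simp; norm_num) (by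
      rw [ha, le_div_iff₀ (by positivity)]
      calc 1 / 2 * (e i ^ 4 * A) ≤ 1 / 2 * (e i ^ 4 * C₂) := by gcongr
        _ ≤ M ^ 2 * e i ^ 4 := by
          have : 1 / 2 * C₂ ≤ M ^ 2 := by nlinarith
          nlinarith [pow_pos hε 4]
        _ = (M * e i ^ 2) ^ 2 := by ring
        _ ≤ u i ^ 2 := by gcongr)
    have hI := typeI_eq φ hA0 (x i)
    rw [← hAdef, hxu] at hI
    rw [← hI, ha] at hα
    have hpos : 0 < typeI φ (ϰ (e i)) (e i) (x i) := (Real.exp_pos _).trans_le hα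
    refine ⟨hpos, ?_, ?_, ?_⟩
    · rw [le_div_iff₀ (by positivity)]
      refine le_trans ?_ ((Real.le_log_iff_exp_le hpos).2 hα)
      rw [huw]
      have h1 : (e i ^ 2 * ρ * w i) ^ 2 / (e i ^ 4 * A) ≤ (ρ * w i) ^ 2 / C₁ := by
        calc _ = (ρ * w i) ^ 2 / A := by field_simp
          _ ≤ _ := by gcongr
      calc _ = -288 * ((ρ * w i) ^ 2 / C₁) := by ring
        _ ≤ _ := by linarith
    · refine div_nonpos_of_nonpos_of_nonneg (Real.log_nonpos hpos.le ?_) (by positivity)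
      exact measureReal_le_one
    · rw [typeII_eq φ hA0, ← hAdef, hxu]
      have hup := upper_tail_le hφ hε (S i) hsum (t := (e i)⁻¹ ^ 2) (by positivity) (fun j => by
        have h1 := (hKb j).trans (min_le_left _ _)
        have h2 : 0 ≤ (e i)⁻¹ ^ 2 * ϰ (e i) j ^ 2 := by positivity
        nlinarith) (u i)
      have hexp : 2 * ((e i)⁻¹ ^ 2) ^ 2 * ∑' j, ϰ (e i) j ^ 4 +
          2 * (e i)⁻¹ ^ 2 * signal φ (ϰ (e i)) (e i) (S i) - (e i)⁻¹ ^ 2 * u i = 2 * A - M := by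
        rw [ha]; simp only [hu]; field_simp; ring
      rw [hexp] at hup
      have h1 : Real.exp (2 * A - M) ≤ 1 / 2 := by
        calc Real.exp (2 * A - M) ≤ Real.exp (-1) := by gcongr; linarith
          _ ≤ 1 / 2 := by
            rw [Real.exp_neg, one_div]
            gcongr
            linarith [Real.add_one_le_exp 1]
      have hc : {y | stat (ϰ (e i)) (e i) y ≤ u i} = {y | u i < stat (ϰ (e i)) (e i) y}ᶜ := by
        ext y; simp
      rw [hc, probReal_compl_eq_one_sub
        (measurableSet_lt measurable_const (measurable_stat _ _))]
      linarith
  intro h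
  obtain ⟨C, hC, hev⟩ := h x (key.mono fun i hi => hi.1) (by
    refine tendsto_of_tendsto_of_tendsto_of_le_of_le' ?_ tendsto_const_nhds
      (key.mono fun i hi => hi.2.1) (key.mono fun i hi => hi.2.2.1)
    simpa using ((hwlim.pow 2).const_mul (288 / C₁)).neg)
  -- Consistency would bound R² by C log 2, because β ≥ 1/2.
  have hbig := hRe.eventually_ge_atTop (C * Real.log 2 + 1)
  obtain ⟨i, hi1, hi2, hi3⟩ := (hev.and (key.and hbig)).exists
  have hβ := hi2.2.2.2
  have hβ1 : typeII φ (ϰ (e i)) (e i) (x i) (S i) ≤ 1 := measureReal_le_one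
  rcases hi1 with h0 | h0
  · linarith
  · have h1 : |Real.log (typeII φ (ϰ (e i)) (e i) (x i) (S i))| ≤ Real.log 2 := by
      rw [abs_of_nonpos (Real.log_nonpos (by linarith) hβ1), ← Real.log_inv]
      refine Real.log_le_log (by positivity) ?_
      rw [inv_le_comm₀ (by linarith) (by norm_num)]
      linarith
    have h2 := mul_le_mul_of_nonneg_left h1 hC.le
    have h3 : 0 ≤ C * Real.log 2 := mul_nonneg hC.le (Real.log_nonneg (by norm_num))
    nlinarith

end LargeDeviations

/-! ### The cutoff and the order of the weights -/

lemma exists_bounds_of_isTheta {l : Filter ℝ} {f g : ℝ → ℝ} (h : f =Θ[l] g)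
    (hf : ∀ᶠ x in l, 0 ≤ f x) (hg : ∀ᶠ x in l, 0 ≤ g x) :
    ∃ c C : ℝ, 0 < c ∧ 0 < C ∧ ∀ᶠ x in l, c * g x ≤ f x ∧ f x ≤ C * g x := by
  obtain ⟨C, hC, h1⟩ := h.1.exists_pos
  obtain ⟨D, hD, h2⟩ := h.2.exists_pos
  refine ⟨D⁻¹, C, inv_pos.2 hD, hC, ?_⟩
  filter_upwards [h1.bound, h2.bound, hf, hg] with x h1 h2 hf hg
  rw [Real.norm_of_nonneg hf, Real.norm_of_nonneg hg] at h1 h2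
  exact ⟨(inv_mul_le_iff₀ hD).2 h2, h1⟩

lemma tendsto_rpow_nhdsGT_zero {a : ℝ} (ha : 0 < a) :
    Tendsto (fun x : ℝ => x ^ a) (𝓝[>] 0) (𝓝 0) := by
  have h := (Real.continuousAt_rpow_const 0 a (Or.inr ha.le)).tendsto
  rw [Real.zero_rpow ha.ne'] at h
  exact h.mono_left nhdsWithin_le_nhds

section Cutoff

variable {ϰ : ℕ+ → ℝ}

lemma card_Iio_succ (k : ℕ+) : (Finset.Iio (k + 1)).card = (k : ℕ) := by
  have : Finset.Iio (k + 1) = Finset.Icc 1 k := by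
    ext j
    simp
  rw [this, PNat.card_Icc]
  simp

/-- For ρ² > 0 the set is nonempty (empty sum at k = 1) and bounded, so the supremum is attained and
k + 1 fails the inequality. For ρ² = 0 the set would be unbounded and `sSup` would default to 0. -/
lemma exists_cutoff (hs : Summable fun j => ϰ j ^ 2) (h0 : 0 < rhoSq ϰ) :
    ∃ k : ℕ+, cutoff ϰ = k ∧ rhoSq ϰ / 2 < ∑ j ∈ Finset.Iio (k + 1), ϰ j ^ 2 := by
  set K : Set ℕ+ := {k : ℕ+ | ∑ j ∈ Finset.Iio k, ϰ j ^ 2 ≤ rhoSq ϰ / 2} with hK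
  obtain ⟨s, hs'⟩ := (hs.hasSum.eventually (lt_mem_nhds (half_lt_self h0))).exists_forall_of_atTop
  have hbd : BddAbove ((fun k : ℕ+ => (k : ℕ)) '' K) := by
    refine ⟨s.sup fun j : ℕ+ => (j : ℕ), ?_⟩
    rintro _ ⟨k, hk, rfl⟩
    by_contra! hcon
    refine absurd hk (not_le.2 (hs' (Finset.Iio k) fun j hj => ?_))
    rw [Finset.mem_Iio, ← PNat.coe_lt_coe]
    exact (Finset.le_sup (f := fun j : ℕ+ => (j : ℕ)) hj).trans_lt hcon
  have hne : ((fun k : ℕ+ => (k : ℕ)) '' K).Nonempty := by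
    refine ⟨1, 1, ?_, rfl⟩
    have : Finset.Iio (1 : ℕ+) = ∅ := by ext j; simp
    simp only [hK, Set.mem_ofPred_eq, this, Finset.sum_empty]
    linarith
  obtain ⟨k, -, hk⟩ := Nat.sSup_mem hne hbd
  refine ⟨k, hk.symm, ?_⟩
  by_contra! hcon
  have h := le_csSup hbd ⟨k + 1, hcon, rfl⟩
  rw [← hk] at h
  simp at h

lemma rhoSq_pos {ε : ℝ} (hs : Summable fun j => ϰ j ^ 2) (hA : 0 < bigA ϰ ε) :
    0 < rhoSq ϰ := by
  refine lt_of_le_of_ne (tsum_nonneg fun j => sq_nonneg _) fun h => ?_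
  have h0 : ∀ j, ϰ j = 0 := by
    have := (hasSum_zero_iff_of_nonneg fun j => sq_nonneg (ϰ j)).1 (by
      rw [h]; exact hs.hasSum)
    intro j
    simpa using congrFun this j
  simp [bigA, h0] at hA

lemma sqAt_coe (k : ℕ+) : sqAt ϰ k = ϰ k ^ 2 := by
  simp [sqAt]

lemma cutoff_pos {ε : ℝ} (hs : Summable fun j => ϰ j ^ 2) (hA : 0 < bigA ϰ ε) :
    1 ≤ cutoff ϰ := by
  obtain ⟨k, hk, -⟩ := exists_cutoff hs (rhoSq_pos hs hA)
  rw [hk]; exact k.2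

/-- The first k_ε weights carry more than half of ρ², so ρ² ≤ 2 k_ε ϰ_1², and ∑ ϰ_j⁴ ≤ ρ² ϰ_1². -/
lemma tsum_pow_four_le {ε : ℝ} (hs : Summable fun j => ϰ j ^ 2)
    (hanti : Antitone fun j => ϰ j ^ 2) (hA : 0 < bigA ϰ ε) :
    ∑' j, ϰ j ^ 4 ≤ 2 * cutoff ϰ * (ϰ 1 ^ 2) ^ 2 := by
  obtain ⟨k, hk, hsum⟩ := exists_cutoff hs (rhoSq_pos hs hA)
  have h1 : ∑ j ∈ Finset.Iio (k + 1), ϰ j ^ 2 ≤ k * ϰ 1 ^ 2 := by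
    have := Finset.sum_le_card_nsmul (Finset.Iio (k + 1)) (fun j => ϰ j ^ 2) (ϰ 1 ^ 2)
      fun j _ => hanti (one_le (a := j))
    rwa [card_Iio_succ, nsmul_eq_mul] at this
  have h2 : ∑' j, ϰ j ^ 4 ≤ rhoSq ϰ * ϰ 1 ^ 2 := by
    rw [rhoSq, ← tsum_mul_right]
    refine (summable_pow_four hs).tsum_le_tsum (fun j => ?_) (hs.mul_right _)
    calc ϰ j ^ 4 = ϰ j ^ 2 * ϰ j ^ 2 := by ring
      _ ≤ _ := mul_le_mul_of_nonneg_left (hanti (one_le (a := j))) (sq_nonneg _)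
  rw [hk]
  nlinarith [sq_nonneg (ϰ 1)]

lemma cutoff_mul_cutoffSq_le {ε : ℝ} (hs : Summable fun j => ϰ j ^ 2)
    (hanti : Antitone fun j => ϰ j ^ 2) (hA : 0 < bigA ϰ ε) :
    cutoff ϰ * cutoffSq ϰ ^ 2 ≤ ∑' j, ϰ j ^ 4 := by
  obtain ⟨k, hk, -⟩ := exists_cutoff hs (rhoSq_pos hs hA)
  rw [cutoffSq, hk, sqAt_coe]
  have h := Finset.card_nsmul_le_sum (Finset.Iio (k + 1)) (fun j => ϰ j ^ 4) ((ϰ k ^ 2) ^ 2)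
    fun j hj => by
      have := hanti (PNat.lt_add_one_iff.1 (Finset.mem_Iio.1 hj))
      calc (ϰ k ^ 2) ^ 2 ≤ (ϰ j ^ 2) ^ 2 := by gcongr
        _ = _ := by ring
  rw [card_Iio_succ, nsmul_eq_mul] at h
  exact h.trans ((summable_pow_four hs).sum_le_tsum _ fun j _ => by positivity)

end Cutoff

/-- The weights `ϰ_j²` have the order `ε^{4-4r-2ω}` up to the cutoff. -/
lemma exists_weight_bounds {r ω : ℝ} {ϰ : ℝ → ℕ+ → ℝ}
    (hsum : ∀ ε : ℝ, 0 < ε → Summable fun j => ϰ ε j ^ 2)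
    (hA1 : CondA1 ϰ) (hA2 : CondA2 ϰ) (hA4 : CondA4 ϰ)
    (hk : (fun ε => (cutoff (ϰ ε) : ℝ)) =Θ[𝓝[>] (0 : ℝ)] fun ε => ε ^ (-4 + 8 * r + 4 * ω)) :
    ∃ c C : ℝ, 0 < c ∧ 0 < C ∧ ∀ᶠ ε in 𝓝[>] (0 : ℝ),
      c * ε ^ (4 - 4 * r - 2 * ω) ≤ cutoffSq (ϰ ε) ∧
        ∀ j, ϰ ε j ^ 2 ≤ C * ε ^ (4 - 4 * r - 2 * ω) := by
  have hpos : ∀ᶠ ε in 𝓝[>] (0 : ℝ), 0 < ε := self_mem_nhdsWithin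
  obtain ⟨k₁, k₂, hk₁, hk₂, hk⟩ := exists_bounds_of_isTheta hk
    (Eventually.of_forall fun _ => Nat.cast_nonneg _) (hpos.mono fun ε hε => by positivity)
  have hsq : ∀ ε, 0 ≤ cutoffSq (ϰ ε) := fun ε => sq_nonneg _
  obtain ⟨b₁, b₂, hb₁, hb₂, hb⟩ := exists_bounds_of_isTheta hA4.1
    (Eventually.of_forall fun _ => sq_nonneg _) (Eventually.of_forall hsq)
  obtain ⟨C₁, C₂, hC₁, hC₂, hA⟩ := hA2
  refine ⟨√(C₁ / (2 * k₂ * b₂ ^ 2)), b₂ * √(C₂ / k₁), by positivity, by positivity, ?_⟩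
  filter_upwards [hpos, hk, hb] with ε hε hk hb
  have hA' := hA ε hε
  have hA0 : 0 < bigA (ϰ ε) ε := by linarith
  have h1 := tsum_pow_four_le (hsum ε hε) (hA1 ε hε) hA0
  have h2 := cutoff_mul_cutoffSq_le (hsum ε hε) (hA1 ε hε) hA0
  rw [tsum_pow_four_eq _ hε] at h1 h2
  set E := ε ^ (-4 + 8 * r + 4 * ω) with hE
  set G := ε ^ (4 - 4 * r - 2 * ω) with hG
  have hE0 : 0 < E := by positivity
  have hG0 : 0 < G := by positivity
  -- By A2 and A4, k_ε ϰ_ε⁴ has order ε⁴; as k_ε has order E, this identity identifies the order of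
  -- ϰ_ε² as G.
  have hEG : E * G ^ 2 = ε ^ 4 := by
    rw [hE, hG, ← Real.rpow_mul_natCast hε.le, ← Real.rpow_add hε, ← Real.rpow_natCast]
    congr 1; push_cast; ring
  set q := cutoffSq (ϰ ε)
  have hq : 0 ≤ q := hsq ε
  have hup : q ≤ √(C₂ / k₁) * G := by
    rw [← abs_of_nonneg hq, ← abs_of_nonneg hG0.le, ← Real.sqrt_sq_eq_abs, ← Real.sqrt_sq_eq_abs,
      ← Real.sqrt_mul (by positivity)]
    refine Real.sqrt_le_sqrt ?_
    rw [div_mul_eq_mul_div, le_div_iff₀ hk₁]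
    have h3 : k₁ * E * q ^ 2 ≤ E * G ^ 2 * C₂ := by
      rw [hEG]
      calc k₁ * E * q ^ 2 ≤ cutoff (ϰ ε) * q ^ 2 := by gcongr; exact hk.1
        _ ≤ ε ^ 4 * bigA (ϰ ε) ε := h2
        _ ≤ ε ^ 4 * C₂ := by gcongr; exact hA'.2.le
    refine le_of_mul_le_mul_left ?_ hE0
    linarith
  refine ⟨?_, fun j => ?_⟩
  · rw [← abs_of_nonneg hq, ← abs_of_nonneg hG0.le, ← Real.sqrt_sq_eq_abs, ← Real.sqrt_sq_eq_abs,
      ← Real.sqrt_mul (by positivity)]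
    refine Real.sqrt_le_sqrt ?_
    rw [div_mul_eq_mul_div, div_le_iff₀ (by positivity)]
    have h3 : E * G ^ 2 * C₁ ≤ 2 * (k₂ * E) * (b₂ * q) ^ 2 := by
      rw [hEG]
      calc ε ^ 4 * C₁ ≤ ε ^ 4 * bigA (ϰ ε) ε := by gcongr; exact hA'.1.le
        _ ≤ 2 * cutoff (ϰ ε) * (ϰ ε 1 ^ 2) ^ 2 := h1
        _ ≤ _ := by
          gcongr
          exacts [hk.2, hb.2]
    refine le_of_mul_le_mul_left ?_ hE0
    linarith
  · calc ϰ ε j ^ 2 ≤ ϰ ε 1 ^ 2 := hA1 ε hε (one_le (a := j))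
      _ ≤ b₂ * q := hb.2
      _ ≤ b₂ * (√(C₂ / k₁) * G) := by gcongr
      _ = _ := by ring

/-! ### Truncation in frequency and the Besov balls -/

section Truncation

variable {φ : ℕ+ → L2}

/-- The projection of `S` on the first `n` elements of the orthonormal system. -/
def trunc (φ : ℕ+ → L2) (n : ℕ+) (S : L2) : L2 := ∑ j ∈ Finset.Iic n, coeff φ S j • φ j

lemma coeff_trunc (hφ : Orthonormal ℝ φ) (n : ℕ+) (S : L2) (j : ℕ+) :
    coeff φ (trunc φ n S) j = if j ≤ n then coeff φ S j else 0 := by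
  split_ifs with h
  · exact hφ.inner_right_sum _ (Finset.mem_Iic.2 h)
  · unfold coeff trunc
    rw [inner_sum]
    refine Finset.sum_eq_zero fun i hi => ?_
    have : j ≠ i := fun e => h (e ▸ Finset.mem_Iic.1 hi)
    rw [inner_smul_right, hφ.2 this, mul_zero]

lemma inner_trunc (φ : ℕ+ → L2) (n : ℕ+) (S T : L2) :
    inner ℝ S (trunc φ n T) = ∑ j ∈ Finset.Iic n, coeff φ S j * coeff φ T j := by
  unfold trunc
  rw [inner_sum]
  refine Finset.sum_congr rfl fun j _ => ?_
  rw [inner_smul_right, real_inner_comm]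
  exact mul_comm _ _

lemma norm_trunc_sq (hφ : Orthonormal ℝ φ) (n : ℕ+) (S : L2) :
    ‖trunc φ n S‖ ^ 2 = ∑ j ∈ Finset.Iic n, coeff φ S j ^ 2 := by
  rw [← real_inner_self_eq_norm_sq, inner_trunc]
  refine Finset.sum_congr rfl fun j hj => ?_
  rw [coeff_trunc hφ, if_pos (Finset.mem_Iic.1 hj), sq]

lemma inner_trunc_trunc (hφ : Orthonormal ℝ φ) (n : ℕ+) (S T : L2) :
    inner ℝ (trunc φ n S) (trunc φ n T) = inner ℝ S (trunc φ n T) := by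
  rw [inner_trunc, inner_trunc]
  refine Finset.sum_congr rfl fun j hj => ?_
  rw [coeff_trunc hφ, if_pos (Finset.mem_Iic.1 hj)]

lemma inner_sub_trunc (hφ : Orthonormal ℝ φ) (n : ℕ+) (S T : L2) :
    inner ℝ (S - trunc φ n S) (trunc φ n T) = 0 := by
  rw [inner_sub_left, inner_trunc_trunc hφ, sub_self]

lemma tsum_coeff_sq_le (hφ : Orthonormal ℝ φ) (S : L2) : ∑' j, coeff φ S j ^ 2 ≤ ‖S‖ ^ 2 := by
  simpa [coeff] using hφ.tsum_inner_products_le (x := S)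

lemma coeff_sub (φ : ℕ+ → L2) (S T : L2) (j : ℕ+) :
    coeff φ (S - T) j = coeff φ S j - coeff φ T j := inner_sub_right _ _ _

lemma signal_ge (hφ : Orthonormal ℝ φ) {ϰ : ℕ+ → ℝ} (hs : Summable fun j => ϰ j ^ 2)
    (hanti : Antitone fun j => ϰ j ^ 2) (ε : ℝ) (S : L2) (n : ℕ+) :
    ε⁻¹ ^ 2 * (ϰ n ^ 2 * ‖trunc φ n S‖ ^ 2) ≤ signal φ ϰ ε S := by
  refine mul_le_mul_of_nonneg_left ?_ (by positivity)
  rw [norm_trunc_sq hφ, Finset.mul_sum]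
  refine le_trans (Finset.sum_le_sum fun j hj => ?_)
    ((summable_mul_coeff_sq hφ S hs).sum_le_tsum (Finset.Iic n) fun j _ => by positivity)
  exact mul_le_mul_of_nonneg_right (hanti (Finset.mem_Iic.1 hj)) (sq_nonneg _)

lemma signal_sub_trunc_le (hφ : Orthonormal ℝ φ) {ϰ : ℕ+ → ℝ} (hs : Summable fun j => ϰ j ^ 2)
    (hanti : Antitone fun j => ϰ j ^ 2) (ε : ℝ) (S : L2) (n : ℕ+) :
    signal φ ϰ ε (S - trunc φ n S) ≤ ε⁻¹ ^ 2 * (ϰ n ^ 2 * ‖S‖ ^ 2) := by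
  refine mul_le_mul_of_nonneg_left ?_ (by positivity)
  have h := (summable_coeff_sq hφ S).mul_left (ϰ n ^ 2)
  refine ((summable_mul_coeff_sq hφ _ hs).tsum_le_tsum (fun j => ?_) h).trans ?_
  · rw [coeff_sub, coeff_trunc hφ]
    split_ifs with hj
    · rw [sub_self]; simp only [ne_eq, OfNat.ofNat_ne_zero, not_false_eq_true, zero_pow, mul_zero]
      positivity
    · rw [sub_zero]
      exact mul_le_mul_of_nonneg_right (hanti (not_le.1 hj).le) (sq_nonneg _)
  · rw [tsum_mul_left]
    exact mul_le_mul_of_nonneg_left (tsum_coeff_sq_le hφ S) (sq_nonneg _)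

/-- The system may be incomplete; the expansion required in the ball gives Parseval, so the
coefficient tail equals the whole squared remainder. -/
lemma norm_sub_trunc_sq_le (hφ : Orthonormal ℝ φ) {s P₀ : ℝ} {S : L2}
    (hS : S ∈ besovBall φ s P₀) (n : ℕ+) :
    ((n : ℕ) : ℝ) ^ (2 * s) * ‖S - trunc φ n S‖ ^ 2 ≤ P₀ := by
  refine le_trans (le_of_eq ?_) (hS.2 (n : ℕ) (by exact_mod_cast n.pos))
  congr 1
  have h1 : inner ℝ S S = ∑' j, coeff φ S j ^ 2 := by
    have h := hS.1.mapL (innerSL ℝ S)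
    refine (h.congr_fun fun j => ?_).tsum_eq.symm
    simp only [innerSL_apply_apply, inner_smul_right, coeff]
    rw [real_inner_comm, sq]
  have h2 : inner ℝ S (trunc φ n S) = ‖trunc φ n S‖ ^ 2 := by
    rw [← inner_trunc_trunc hφ, real_inner_self_eq_norm_sq]
  rw [← real_inner_self_eq_norm_sq, inner_sub_left, inner_sub_right, inner_sub_right,
    real_inner_comm S (trunc φ n S), h2, h1, real_inner_self_eq_norm_sq, norm_trunc_sq hφ,
    sub_self, sub_zero]
  have h3 := (summable_coeff_sq hφ S).sum_add_tsum_compl (s := Finset.Iic n)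
  rw [← h3, add_sub_cancel_left]
  have e : ((Finset.Iic n : Finset ℕ+) : Set ℕ+)ᶜ = {j : ℕ+ | ((n : ℕ) : ℝ) < ((j : ℕ) : ℝ)} := by
    ext j
    simp
  rw [e]
  rfl

/-- The tail vanishes for frequencies from n on; below n both factors are at most n^(2s) and ‖S‖².
-/
lemma trunc_mem_besovBall (hφ : Orthonormal ℝ φ) {s P₀ : ℝ} (hs : 0 ≤ s) (hP : 0 ≤ P₀) {S : L2}
    (n : ℕ+) (h : ((n : ℕ) : ℝ) ^ (2 * s) * ‖S‖ ^ 2 ≤ P₀) : trunc φ n S ∈ besovBall φ s P₀ := by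
  constructor
  · have : HasSum (fun j => coeff φ (trunc φ n S) j • φ j)
        (∑ j ∈ Finset.Iic n, coeff φ (trunc φ n S) j • φ j) :=
      hasSum_sum_of_ne_finset_zero fun j hj => by
        rw [coeff_trunc hφ, if_neg (by simpa using hj), zero_smul]
    convert this using 1
    refine Finset.sum_congr rfl fun j hj => ?_
    rw [coeff_trunc hφ, if_pos (Finset.mem_Iic.1 hj)]
  · intro lam hlam
    rcases le_or_gt ((n : ℕ) : ℝ) lam with hn | hn
    · have : ∀ j : {j : ℕ+ // lam < ((j : ℕ) : ℝ)}, coeff φ (trunc φ n S) j ^ 2 = 0 := by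
        rintro ⟨j, hj⟩
        have : n < j := by
          have h1 : ((n : ℕ) : ℝ) < (j : ℕ) := hn.trans_lt hj
          exact_mod_cast h1
        rw [coeff_trunc hφ, if_neg (not_le.2 this)]
        simp
      simp only [this, tsum_zero, mul_zero]
      exact hP
    · refine le_trans ?_ h
      have h0 : 0 ≤ ∑' j : {j : ℕ+ // lam < ((j : ℕ) : ℝ)}, coeff φ (trunc φ n S) j ^ 2 :=
        tsum_nonneg fun j => sq_nonneg _
      refine mul_le_mul (Real.rpow_le_rpow hlam.le hn.le (by positivity)) ?_ h0 (by positivity)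
      refine (Summable.tsum_subtype_le _ {j : ℕ+ | lam < ((j : ℕ) : ℝ)} (fun j => sq_nonneg _)
        (summable_coeff_sq hφ (trunc φ n S))).trans ?_
      refine le_trans ?_ (tsum_coeff_sq_le hφ S)
      refine (summable_coeff_sq hφ _).tsum_le_tsum (fun j => ?_) (summable_coeff_sq hφ S)
      rw [coeff_trunc hφ]
      split_ifs
      · exact le_rfl
      · simp only [ne_eq, OfNat.ofNat_ne_zero, not_false_eq_true, zero_pow]
        positivity

lemma zero_mem_besovBall (φ : ℕ+ → L2) (s : ℝ) {P₀ : ℝ} (hP : 0 ≤ P₀) :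
    (0 : L2) ∈ besovBall φ s P₀ := by
  constructor
  · simp [coeff]
  · intro lam _
    simp [coeff, hP]

end Truncation

/-! ### Concentration on low frequencies -/

/-- The frequency `[c k_ε]`. -/
def level (ϰ : ℕ+ → ℝ) (c : ℝ) : ℕ+ := ⌊c * (cutoff ϰ : ℝ)⌋₊.toPNat'

lemma level_bounds {ϰ : ℕ+ → ℝ} {c : ℝ} (hc : 1 < c) (hk : 1 ≤ cutoff ϰ) :
    c * cutoff ϰ / 2 ≤ ((level ϰ c : ℕ) : ℝ) ∧ ((level ϰ c : ℕ) : ℝ) ≤ c * cutoff ϰ := by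
  have hk' : (1 : ℝ) ≤ cutoff ϰ := by exact_mod_cast hk
  have h1 : 1 ≤ c * (cutoff ϰ : ℝ) := by nlinarith
  have h2 : 1 ≤ ⌊c * (cutoff ϰ : ℝ)⌋₊ := Nat.one_le_floor_iff _ |>.2 h1
  have e : (level ϰ c : ℕ) = ⌊c * (cutoff ϰ : ℝ)⌋₊ := by
    rw [level, Nat.toPNat'_coe, if_pos (by omega)]
  rw [e]
  have h3 := Nat.lt_floor_add_one (c * (cutoff ϰ : ℝ))
  have h4 : (1 : ℝ) ≤ ⌊c * (cutoff ϰ : ℝ)⌋₊ := by exact_mod_cast h2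
  exact ⟨by linarith, Nat.floor_le (by linarith)⟩

/-- The energy of `S ε` is concentrated, up to `δ ε^{2r}`, on frequencies of the order of the
cutoff. -/
def LowFrequency (φ : ℕ+ → L2) (ϰ : ℝ → ℕ+ → ℝ) (r : ℝ) (S : ℝ → L2) : Prop :=
  ∀ δ : ℝ, 0 < δ → ∃ c : ℝ, 1 < c ∧ ∀ᶠ ε in 𝓝[>] (0 : ℝ),
    ‖S ε - trunc φ (level (ϰ ε) c) (S ε)‖ ≤ δ * ε ^ (2 * r)

/-- Truncation is an orthogonal projection, hence a best approximation from its range. -/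
lemma norm_sub_trunc_le {φ : ℕ+ → L2} (hφ : Orthonormal ℝ φ) (n : ℕ+) (S T : L2) :
    ‖S - trunc φ n S‖ ≤ ‖S - trunc φ n T‖ := by
  have h : ‖S - trunc φ n S‖ ^ 2 = inner ℝ (S - trunc φ n S) (S - trunc φ n T) := by
    rw [← real_inner_self_eq_norm_sq, inner_sub_right, inner_sub_right, inner_sub_trunc hφ,
      inner_sub_trunc hφ]
  have h1 := real_inner_le_norm (S - trunc φ n S) (S - trunc φ n T)
  by_contra! hcon
  nlinarith [norm_nonneg (S - trunc φ n T)]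

lemma norm_trunc_le {φ : ℕ+ → L2} (hφ : Orthonormal ℝ φ) (n : ℕ+) (S : L2) :
    ‖trunc φ n S‖ ≤ ‖S‖ := by
  have h := real_inner_le_norm S (trunc φ n S)
  rw [← inner_trunc_trunc hφ, real_inner_self_eq_norm_sq] at h
  by_contra! hcon
  nlinarith [norm_nonneg S]

lemma smoothness_exponent {r ω ε : ℝ} (hω₁ : 2 * ω < 1 - 2 * r) (hr₁ : r < 1 / 2) (hε : 0 < ε) :
    (ε ^ (-4 + 8 * r + 4 * ω)) ^ (2 * (r / (2 - 4 * r - 2 * ω))) * (ε ^ (2 * r)) ^ 2 = 1 := by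
  have hp : 2 - 4 * r - 2 * ω ≠ 0 := by linarith
  have hE : -4 + 8 * r + 4 * ω = -2 * (2 - 4 * r - 2 * ω) := by ring
  generalize 2 - 4 * r - 2 * ω = p at hp hE
  rw [hE, ← Real.rpow_mul hε.le, ← Real.rpow_mul_natCast hε.le, ← Real.rpow_add hε,
    ← Real.rpow_zero ε]
  congr 1
  push_cast
  field_simp
  ring

/-! ### Low frequencies, Besov approximation and pure consistency -/

section Main

variable {φ : ℕ+ → L2} {r ω : ℝ} {ϰ : ℝ → ℕ+ → ℝ} {S : ℝ → L2}

lemma one_le_cutoff (hsum : ∀ ε : ℝ, 0 < ε → Summable fun j => ϰ ε j ^ 2) (hA2 : CondA2 ϰ)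
    {ε : ℝ} (hε : 0 < ε) : 1 ≤ cutoff (ϰ ε) := by
  obtain ⟨C₁, C₂, hC₁, hC₂, hA⟩ := hA2
  exact cutoff_pos (hsum ε hε) (hC₁.trans (hA ε hε).1)

lemma lowFrequency_of_besovBall (hφ : Orthonormal ℝ φ) (hr₀ : 0 < r) (hr₁ : r < 1 / 2)
    (hω₁ : 2 * ω < 1 - 2 * r) (hsum : ∀ ε : ℝ, 0 < ε → Summable fun j => ϰ ε j ^ 2)
    (hA2 : CondA2 ϰ)
    (hk : (fun ε => (cutoff (ϰ ε) : ℝ)) =Θ[𝓝[>] (0 : ℝ)] fun ε => ε ^ (-4 + 8 * r + 4 * ω))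
    (h : ∀ δ : ℝ, 0 < δ → ∃ (P₀ : ℝ) (S₁ : ℝ → L2), 0 < P₀ ∧
      (∀ ε : ℝ, 0 < ε → S₁ ε ∈ besovBall φ (r / (2 - 4 * r - 2 * ω)) P₀) ∧
        ∃ ε₀ : ℝ, 0 < ε₀ ∧ ∀ ε : ℝ, 0 < ε → ε < ε₀ → ‖S ε - S₁ ε‖ ≤ δ * ε ^ (2 * r)) :
    LowFrequency φ ϰ r S := by
  have hpos : ∀ᶠ ε in 𝓝[>] (0 : ℝ), 0 < ε := self_mem_nhdsWithin
  obtain ⟨k₁, k₂, hk₁, hk₂, hk⟩ := exists_bounds_of_isTheta hk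
    (Eventually.of_forall fun _ => Nat.cast_nonneg _) (hpos.mono fun ε hε => by positivity)
  intro δ hδ
  obtain ⟨P₀, S₁, hP₀, hS₁, ε₀, hε₀, hclose⟩ := h (δ / 2) (half_pos hδ)
  set s := r / (2 - 4 * r - 2 * ω) with hs
  have hs0 : 0 < 2 * s := by
    have : 0 < 2 - 4 * r - 2 * ω := by linarith
    positivity
  have hlim : Tendsto (fun c : ℝ => (c * (k₁ / 2)) ^ (2 * s)) atTop atTop :=
    (tendsto_rpow_atTop hs0).comp (tendsto_id.atTop_mul_const (half_pos hk₁))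
  -- Rounding leaves a level of at least c k_ε/2. For this c the Besov tail of S₁ beyond it is at
  -- most (δ/2) ε^(2r).
  obtain ⟨c, hcP, hc⟩ := ((hlim.eventually_ge_atTop (P₀ / (δ / 2) ^ 2)).and
    (eventually_gt_atTop 1)).exists
  refine ⟨c, hc, ?_⟩
  filter_upwards [hpos, hk, (eventually_lt_nhds hε₀).filter_mono nhdsWithin_le_nhds] with
    ε hε hk hlt
  set n := level (ϰ ε) c
  set g := ε ^ (2 * r) with hg
  have hg0 : 0 < g := by positivity
  set x := ‖S₁ ε - trunc φ n (S₁ ε)‖ with hx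
  have hn : c * (k₁ / 2) * ε ^ (-4 + 8 * r + 4 * ω) ≤ ((n : ℕ) : ℝ) := by
    refine le_trans ?_ (level_bounds hc (one_le_cutoff hsum hA2 hε)).1
    have := mul_le_mul_of_nonneg_left hk.1 (by linarith : 0 ≤ c)
    linarith
  have h1 : P₀ / (δ / 2) ^ 2 * (x ^ 2 / g ^ 2) ≤ P₀ := by
    refine le_trans ?_ (norm_sub_trunc_sq_le hφ (hS₁ ε hε) n)
    have hexp := smoothness_exponent hω₁ hr₁ hε
    rw [← hs, ← hg] at hexp
    have hn2 := Real.rpow_le_rpow (by positivity) hn hs0.le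
    rw [Real.mul_rpow (by positivity) (by positivity), eq_div_of_mul_eq (by positivity) hexp]
      at hn2
    calc _ ≤ (c * (k₁ / 2)) ^ (2 * s) * (x ^ 2 / g ^ 2) := by gcongr
      _ = (c * (k₁ / 2)) ^ (2 * s) * (1 / g ^ 2) * x ^ 2 := by ring
      _ ≤ _ := by gcongr
  have h2 : x ≤ δ / 2 * g := by
    refine le_of_sq_le_sq ?_ (by positivity)
    have : x ^ 2 / g ^ 2 ≤ (δ / 2) ^ 2 := by
      rw [div_mul_eq_mul_div, div_le_iff₀ (by positivity)] at h1
      exact le_of_mul_le_mul_left h1 hP₀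
    rw [div_le_iff₀ (by positivity)] at this
    linarith
  calc _ ≤ ‖S ε - trunc φ n (S₁ ε)‖ := norm_sub_trunc_le hφ _ _ _
    _ ≤ ‖S ε - S₁ ε‖ + x := norm_sub_le_norm_sub_add_norm_sub _ _ _
    _ ≤ δ / 2 * g + δ / 2 * g := add_le_add (hclose ε hε hlt) h2
    _ = δ * g := by ring

lemma besovBall_of_lowFrequency (hφ : Orthonormal ℝ φ) (hr₀ : 0 < r) (hr₁ : r < 1 / 2)
    (hω₁ : 2 * ω < 1 - 2 * r) (hsum : ∀ ε : ℝ, 0 < ε → Summable fun j => ϰ ε j ^ 2)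
    (hA2 : CondA2 ϰ)
    (hk : (fun ε => (cutoff (ϰ ε) : ℝ)) =Θ[𝓝[>] (0 : ℝ)] fun ε => ε ^ (-4 + 8 * r + 4 * ω))
    (hS : (fun ε => ‖S ε‖) =Θ[𝓝[>] (0 : ℝ)] fun ε => ε ^ (2 * r))
    (h : LowFrequency φ ϰ r S) {δ : ℝ} (hδ : 0 < δ) :
    ∃ (P₀ : ℝ) (S₁ : ℝ → L2), 0 < P₀ ∧
      (∀ ε : ℝ, 0 < ε → S₁ ε ∈ besovBall φ (r / (2 - 4 * r - 2 * ω)) P₀) ∧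
        ∃ ε₀ : ℝ, 0 < ε₀ ∧ ∀ ε : ℝ, 0 < ε → ε < ε₀ → ‖S ε - S₁ ε‖ ≤ δ * ε ^ (2 * r) := by
  have hpos : ∀ᶠ ε in 𝓝[>] (0 : ℝ), 0 < ε := self_mem_nhdsWithin
  have hgpos : ∀ᶠ ε in 𝓝[>] (0 : ℝ), 0 ≤ ε ^ (2 * r) := hpos.mono fun ε hε => by positivity
  obtain ⟨k₁, k₂, hk₁, hk₂, hk⟩ := exists_bounds_of_isTheta hk
    (Eventually.of_forall fun _ => Nat.cast_nonneg _) (hpos.mono fun ε hε => by positivity)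
  obtain ⟨d, D, hd, hD, hS⟩ := exists_bounds_of_isTheta hS
    (Eventually.of_forall fun _ => norm_nonneg _) hgpos
  obtain ⟨c, hc, hc'⟩ := h δ hδ
  have hall := hk.and (hS.and hc')
  obtain ⟨ε₀, hε₀, hev⟩ := mem_nhdsGT_iff_exists_Ioo_subset.1 hall
  replace hε₀ : 0 < ε₀ := hε₀
  set s := r / (2 - 4 * r - 2 * ω) with hs
  have hs0 : 0 < s := by
    have : 0 < 2 - 4 * r - 2 * ω := by linarith
    positivity
  -- Truncations serve as the approximants; from ε₀ on, where the asymptotic bounds are not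
  -- available, 0 lies in the ball.
  refine ⟨(c * k₂) ^ (2 * s) * D ^ 2,
    fun ε => if ε < ε₀ then trunc φ (level (ϰ ε) c) (S ε) else 0, by positivity,
    fun ε hε => ?_, ε₀, hε₀, fun ε hε hlt => ?_⟩
  · dsimp only
    split_ifs with hlt
    · obtain ⟨hk, hS, -⟩ := hev ⟨hε, hlt⟩
      refine trunc_mem_besovBall hφ hs0.le (by positivity) _ ?_
      have hn := (level_bounds hc (one_le_cutoff hsum hA2 hε)).2
      have hexp := smoothness_exponent hω₁ hr₁ hε
      rw [← hs] at hexp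
      calc _ ≤ (c * (k₂ * ε ^ (-4 + 8 * r + 4 * ω))) ^ (2 * s) * (D * ε ^ (2 * r)) ^ 2 := by
            gcongr
            · exact hn.trans (by gcongr; exact hk.2)
            · exact hS.2
        _ = (c * k₂) ^ (2 * s) * D ^ 2 *
            ((ε ^ (-4 + 8 * r + 4 * ω)) ^ (2 * s) * (ε ^ (2 * r)) ^ 2) := by
            rw [← mul_assoc, Real.mul_rpow (by positivity) (by positivity)]
            ring
        _ = _ := by rw [hexp, mul_one]
    · exact zero_mem_besovBall φ s (by positivity)
  · simp only [if_pos hlt]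
    exact (hev ⟨hε, hlt⟩).2.2

/-- The product has order at most ε^(2-4r-4ω), a positive power exactly because 2ω < 1 - 2r. -/
lemma weight_negligible (hω₁ : 2 * ω < 1 - 2 * r) {C : ℝ}
    (hb : ∀ᶠ ε in 𝓝[>] (0 : ℝ), ∀ j, ϰ ε j ^ 2 ≤ C * ε ^ (4 - 4 * r - 2 * ω))
    (η : ℝ) (hη : 0 < η) :
    ∀ᶠ ε in 𝓝[>] (0 : ℝ), ∀ j, ε ^ (-2 * ω) * (ε⁻¹ ^ 2 * ϰ ε j ^ 2) ≤ η := by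
  have hpos : ∀ᶠ ε in 𝓝[>] (0 : ℝ), 0 < ε := self_mem_nhdsWithin
  have hlim : Tendsto (fun ε : ℝ => C * ε ^ (2 - 4 * r - 4 * ω)) (𝓝[>] 0) (𝓝 0) := by
    simpa using (tendsto_rpow_nhdsGT_zero (by linarith : 0 < 2 - 4 * r - 4 * ω)).const_mul C
  filter_upwards [hpos, hb, hlim.eventually_le_const hη] with ε hε hb hle j
  refine le_trans ?_ hle
  have e : ε⁻¹ ^ 2 = ε ^ (-2 : ℝ) := by
    rw [Real.rpow_neg hε.le, inv_pow]
    norm_cast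
  calc _ ≤ ε ^ (-2 * ω) * (ε⁻¹ ^ 2 * (C * ε ^ (4 - 4 * r - 2 * ω))) := by gcongr; exact hb j
    _ = C * (ε ^ (-2 * ω) * ε ^ (-2 : ℝ) * ε ^ (4 - 4 * r - 2 * ω)) := by rw [e]; ring
    _ = _ := by
      rw [← Real.rpow_add hε, ← Real.rpow_add hε]
      congr 2; ring

lemma signal_scale {ε : ℝ} (hε : 0 < ε) :
    ε⁻¹ ^ 2 * (ε ^ (4 - 4 * r - 2 * ω) * (ε ^ (2 * r)) ^ 2) = ε ^ 2 * ε ^ (-2 * ω) := by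
  have h : ε ^ (4 - 4 * r - 2 * ω) * (ε ^ (2 * r)) ^ 2 = ε ^ 4 * ε ^ (-2 * ω) := by
    rw [← Real.rpow_mul_natCast hε.le, ← Real.rpow_add hε, ← Real.rpow_natCast ε 4,
      ← Real.rpow_add hε]
    congr 1; push_cast; ring
  rw [h]
  field_simp

/-- Orthogonality gives ‖S₁‖² = ⟨S₁, S⟩. As S has little energy beyond c k_ε, most of this inner
product comes from low frequencies, so S₁ has energy of order ε^(4r) there. -/
lemma ldConsistentAlong_of_lowFrequency {ι : Type} {l : Filter ι} {e : ι → ℝ} {S₁ : ι → L2}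
    (hφ : Orthonormal ℝ φ)
    (hω₁ : 2 * ω < 1 - 2 * r) (hsum : ∀ ε : ℝ, 0 < ε → Summable fun j => ϰ ε j ^ 2)
    (hA1 : CondA1 ϰ) (hA2 : CondA2 ϰ) (hA4 : CondA4 ϰ)
    (hk : (fun ε => (cutoff (ϰ ε) : ℝ)) =Θ[𝓝[>] (0 : ℝ)] fun ε => ε ^ (-4 + 8 * r + 4 * ω))
    (hS : (fun ε => ‖S ε‖) =Θ[𝓝[>] (0 : ℝ)] fun ε => ε ^ (2 * r))
    (h : LowFrequency φ ϰ r S) (he : Tendsto e l (𝓝[>] (0 : ℝ)))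
    (horth : ∀ i, inner ℝ (S₁ i) (S (e i) - S₁ i) = 0) {c₁ : ℝ} (hc₁ : 0 < c₁)
    (hnorm : ∀ᶠ i in l, c₁ * e i ^ (2 * r) ≤ ‖S₁ i‖) :
    LDConsistentAlong φ ϰ (fun ε => ε ^ (-2 * ω)) l e S₁ := by
  have hpos : ∀ᶠ ε in 𝓝[>] (0 : ℝ), 0 < ε := self_mem_nhdsWithin
  have hgpos : ∀ᶠ ε in 𝓝[>] (0 : ℝ), 0 ≤ ε ^ (2 * r) := hpos.mono fun ε hε => by positivity
  obtain ⟨d, D, hd, hD, hS⟩ := exists_bounds_of_isTheta hS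
    (Eventually.of_forall fun _ => norm_nonneg _) hgpos
  obtain ⟨w, W, hw, hW, hwb⟩ := exists_weight_bounds hsum hA1 hA2 hA4 hk
  -- Since ‖S₁‖ ≤ ‖S‖ ≤ D ε^(2r), this δ limits the high-frequency part of ⟨S₁, S⟩ to half of c₁²
  -- ε^(4r).
  obtain ⟨c, hc, hlow⟩ := h (c₁ ^ 2 / (2 * D)) (by positivity)
  obtain ⟨C, hC, hCb⟩ := hA4.2 c hc
  refine ldConsistentAlong_of_signal_ge hφ hsum hA2 (hpos.mono fun ε hε => by positivity)
    (weight_negligible hω₁ (hwb.mono fun ε h => h.2)) he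
    (c := C * w * (c₁ ^ 2 / (2 * D)) ^ 2) (by positivity) ?_
  filter_upwards [he.eventually hpos, he.eventually hS, he.eventually hwb, he.eventually hlow,
    hnorm] with i hε hS hwb hlow hnorm
  set n := level (ϰ (e i)) c
  set g := e i ^ (2 * r) with hg
  have hg0 : 0 < g := by positivity
  have horth := horth i
  rw [inner_sub_right, real_inner_self_eq_norm_sq, sub_eq_zero] at horth
  have hle : ‖S₁ i‖ ≤ ‖S (e i)‖ := by
    have := real_inner_le_norm (S₁ i) (S (e i))
    by_contra! hcon
    nlinarith [norm_nonneg (S (e i))]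
  have h1 : inner ℝ (S₁ i) (trunc φ n (S (e i))) ≤ ‖trunc φ n (S₁ i)‖ * (D * g) := by
    rw [← inner_trunc_trunc hφ]
    refine (real_inner_le_norm _ _).trans ?_
    gcongr
    exact (norm_trunc_le hφ n _).trans hS.2
  have h2 : inner ℝ (S₁ i) (S (e i) - trunc φ n (S (e i))) ≤
      D * g * (c₁ ^ 2 / (2 * D) * g) := by
    refine (real_inner_le_norm _ _).trans ?_
    gcongr
    exact hle.trans hS.2
  have h3 : (c₁ * g) ^ 2 ≤ ‖S₁ i‖ ^ 2 := by gcongr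
  have h4 : c₁ ^ 2 / (2 * D) * g ≤ ‖trunc φ n (S₁ i)‖ := by
    rw [inner_sub_right, horth] at h2
    have h5 : D * g * (c₁ ^ 2 / (2 * D) * g) = c₁ ^ 2 / 2 * g ^ 2 := by field_simp
    refine le_of_mul_le_mul_left ?_ (by positivity : 0 < D * g)
    rw [h5]
    rw [h5] at h2
    nlinarith
  refine le_trans ?_ (signal_ge hφ (hsum _ hε) (hA1 _ hε) (e i) (S₁ i) n)
  have h6 : C * (w * e i ^ (4 - 4 * r - 2 * ω)) ≤ ϰ (e i) n ^ 2 :=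
    (mul_le_mul_of_nonneg_left hwb.1 hC.le).trans (hCb _ hε)
  calc _ = C * w * (c₁ ^ 2 / (2 * D)) ^ 2 *
        ((e i)⁻¹ ^ 2 * (e i ^ (4 - 4 * r - 2 * ω) * g ^ 2)) := by rw [hg, signal_scale hε]
    _ = (e i)⁻¹ ^ 2 * (C * (w * e i ^ (4 - 4 * r - 2 * ω)) * (c₁ ^ 2 / (2 * D) * g) ^ 2) := by ring
    _ ≤ _ := by gcongr

lemma lowFrequency_of_purelyLDConsistent (hφ : Orthonormal ℝ φ)
    (hω₀ : 0 < 2 * ω)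
    (hω₁ : 2 * ω < 1 - 2 * r) (hsum : ∀ ε : ℝ, 0 < ε → Summable fun j => ϰ ε j ^ 2)
    (hA1 : CondA1 ϰ) (hA2 : CondA2 ϰ) (hA3 : CondA3 ϰ) (hA4 : CondA4 ϰ)
    (hk : (fun ε => (cutoff (ϰ ε) : ℝ)) =Θ[𝓝[>] (0 : ℝ)] fun ε => ε ^ (-4 + 8 * r + 4 * ω))
    (hS : (fun ε => ‖S ε‖) =Θ[𝓝[>] (0 : ℝ)] fun ε => ε ^ (2 * r))
    (h : PurelyLDConsistent φ ϰ (fun ε => ε ^ (-2 * ω)) r S) : LowFrequency φ ϰ r S := by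
  have hpos : ∀ᶠ ε in 𝓝[>] (0 : ℝ), 0 < ε := self_mem_nhdsWithin
  have hgpos : ∀ᶠ ε in 𝓝[>] (0 : ℝ), 0 ≤ ε ^ (2 * r) := hpos.mono fun ε hε => by positivity
  by_contra hcon
  unfold LowFrequency at hcon
  push Not at hcon
  obtain ⟨δ, hδ, hcon⟩ := hcon
  -- Failure at every c is used at c = i + 2 with ε_i < 1/(i + 1): the cutoff multiple grows along
  -- the sequence, so A3 makes the signal of the remainders o(ε²R).
  have hex : ∀ i : ℕ, ∃ ε : ℝ, 0 < ε ∧ ε < 1 / ((i : ℝ) + 1) ∧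
      δ * ε ^ (2 * r) < ‖S ε - trunc φ (level (ϰ ε) (i + 2)) (S ε)‖ := by
    intro i
    have hi : (0 : ℝ) < 1 / ((i : ℝ) + 1) := by positivity
    obtain ⟨ε, h1, h2, h3⟩ := ((hcon (i + 2) (by linarith [(Nat.cast_nonneg i : (0 : ℝ) ≤ i)])
      ).and_eventually (hpos.and ((eventually_lt_nhds hi).filter_mono nhdsWithin_le_nhds))).exists
    exact ⟨ε, h2, h3, h1⟩
  choose e he0 helt hlt using hex
  have he : Tendsto e atTop (𝓝 0) :=
    squeeze_zero (fun i => (he0 i).le) (fun i => (helt i).le) tendsto_one_div_add_atTop_nhds_zero_nat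
  have he' : Tendsto e atTop (𝓝[>] (0 : ℝ)) :=
    tendsto_nhdsWithin_iff.2 ⟨he, Eventually.of_forall he0⟩
  refine h.2 ⟨e, fun i => S (e i) - trunc φ (level (ϰ (e i)) (i + 2)) (S (e i)), δ, he0, he, hδ,
    fun i => ?_, hlt, ?_⟩
  · rw [sub_sub_cancel, inner_sub_trunc hφ]
  obtain ⟨d, D, hd, hD, hS⟩ := exists_bounds_of_isTheta hS
    (Eventually.of_forall fun _ => norm_nonneg _) hgpos
  obtain ⟨w, W, hw, hW, hwb⟩ := exists_weight_bounds hsum hA1 hA2 hA4 hk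
  obtain ⟨C, lam, hC, hlam, hCb⟩ := hA3
  refine not_ldConsistentAlong_of_signal hφ hsum hA2
    (tendsto_rpow_neg_nhdsGT_zero (by linarith))
    (weight_negligible hω₁ (hwb.mono fun ε h => h.2)) he' ?_
  have hlim : Tendsto (fun i : ℕ => C * W * D ^ 2 * ((i : ℝ) + 2) ^ (-lam)) atTop (𝓝 0) := by
    have h1 : Tendsto (fun i : ℕ => (i : ℝ) + 2) atTop atTop :=
      tendsto_atTop_add_const_right _ _ tendsto_natCast_atTop_atTop
    simpa using ((tendsto_rpow_neg_atTop (by linarith : 0 < lam)).comp h1).const_mul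
      (C * W * D ^ 2)
  refine squeeze_zero' ?_ ?_ hlim
  · filter_upwards with i
    have := he0 i
    exact div_nonneg (signal_nonneg _ _ _ _) (by positivity)
  filter_upwards [he'.eventually hS, he'.eventually hwb] with i hS hwb
  have hε := he0 i
  rw [div_le_iff₀ (by positivity)]
  refine (signal_sub_trunc_le hφ (hsum _ hε) (hA1 _ hε) _ _ _).trans ?_
  have h1 := (hCb ((i : ℝ) + 1) (by positivity) (e i) hε).le
  have e1 : 1 + ((i : ℝ) + 1) = i + 2 := by ring
  rw [e1] at h1
  calc _ ≤ (e i)⁻¹ ^ 2 * (C * ((i : ℝ) + 2) ^ (-lam) * (W * e i ^ (4 - 4 * r - 2 * ω)) *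
        (D * e i ^ (2 * r)) ^ 2) := by
        gcongr
        · refine h1.trans ?_
          gcongr
          exact hwb.2 _
        · exact hS.2
    _ = C * W * D ^ 2 * ((i : ℝ) + 2) ^ (-lam) *
        ((e i)⁻¹ ^ 2 * (e i ^ (4 - 4 * r - 2 * ω) * (e i ^ (2 * r)) ^ 2)) := by ring
    _ = _ := by rw [signal_scale hε]

end Main

end SignalDetection

end

theorem mainTheorem5
    (φ : ℕ+ → SignalDetection.L2) (hφ : Orthonormal ℝ φ)
    (r ω : ℝ) (hr₀ : 0 < r) (hr₁ : r < 1 / 2) (hω₀ : 0 < 2 * ω) (hω₁ : 2 * ω < 1 - 2 * r)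
    (ϰ : ℝ → ℕ+ → ℝ)
    (hsum : ∀ ε : ℝ, 0 < ε → Summable fun j => ϰ ε j ^ 2)
    (hA1 : SignalDetection.CondA1 ϰ) (hA2 : SignalDetection.CondA2 ϰ)
    (hA3 : SignalDetection.CondA3 ϰ) (hA4 : SignalDetection.CondA4 ϰ)
    (hk : (fun ε => (SignalDetection.cutoff (ϰ ε) : ℝ)) =Θ[𝓝[>] (0 : ℝ)]
      fun ε => ε ^ (-4 + 8 * r + 4 * ω))
    (S : ℝ → SignalDetection.L2)
    (hS : (fun ε => ‖S ε‖) =Θ[𝓝[>] (0 : ℝ)] fun ε => ε ^ (2 * r)) :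
    SignalDetection.PurelyLDConsistent φ ϰ (fun ε => ε ^ (-2 * ω)) r S ↔
      ∀ δ : ℝ, 0 < δ → ∃ (P₀ : ℝ) (S₁ : ℝ → SignalDetection.L2), 0 < P₀ ∧
        (∀ ε : ℝ, 0 < ε →
          S₁ ε ∈ SignalDetection.besovBall φ (r / (2 - 4 * r - 2 * ω)) P₀) ∧
        ∃ ε₀ : ℝ, 0 < ε₀ ∧ ∀ ε : ℝ, 0 < ε → ε < ε₀ →
          ‖S ε - S₁ ε‖ ≤ δ * ε ^ (2 * r) := by
  constructor
  · intro h δ hδ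
    exact SignalDetection.besovBall_of_lowFrequency hφ hr₀ hr₁ hω₁ hsum hA2 hk hS
      (SignalDetection.lowFrequency_of_purelyLDConsistent hφ hω₀ hω₁ hsum hA1 hA2 hA3 hA4
        hk hS h) hδ
  · intro h
    have hlow := SignalDetection.lowFrequency_of_besovBall hφ hr₀ hr₁ hω₁ hsum hA2 hk h
    have hpos : ∀ᶠ ε in 𝓝[>] (0 : ℝ), 0 < ε := self_mem_nhdsWithin
    obtain ⟨d, D, hd, -, hb⟩ := SignalDetection.exists_bounds_of_isTheta hS
      (Eventually.of_forall fun _ => norm_nonneg _) (hpos.mono fun ε hε => by positivity)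
    -- The family S is its own component: S - S = 0 is orthogonal to S.
    refine ⟨SignalDetection.ldConsistentAlong_of_lowFrequency hφ hω₁ hsum hA1 hA2 hA4 hk hS
      hlow tendsto_id (fun ε => by simp) hd
      (hb.mono fun ε h => h.1), ?_⟩
    rintro ⟨e, S₁, c₁, he0, he, hc₁, horth, hnorm, hnot⟩
    exact hnot (SignalDetection.ldConsistentAlong_of_lowFrequency hφ hω₁ hsum hA1 hA2 hA4 hk
      hS hlow (tendsto_nhdsWithin_iff.2 ⟨he, Eventually.of_forall he0⟩) horth hc₁
      (Eventually.of_forall fun i => (hnorm i).le))
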